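/- Let $\rho$ be a state (density matrix) on $\mathbb C^d$ with reference basis $\{|i\rangle\}_{i=1}^d$, let $\Delta(X)=\sum_i |i\rangle\langle i|X|i\rangle\langle i|$, and let $\varepsilon\ge 0$. An incoherent state is a state $\omega$ with $\omega=\Delta(\omega)$, and an operator $K$ is incoherent if $K\sigma K^\dagger/\operatorname{Tr}(K\sigma K^\dagger)$ is an incoherent state for every incoherent state $\sigma$ with $\operatorname{Tr}(K\sigma K^\dagger)\neq 0$. Let $\mathcal O$ be any one of the following classes of quantum channels (completely positive trace-preserving maps) on $\mathbb C^d$: MIO (channels mapping incoherent states to incoherent states), DIO (channels commuting with $\Delta$), IO (channels with a Kraus decomposition $\{K_\ell\}$ into incoherent operators), SIO (channels with a Kraus decomposition in which all $K_\ell$ and all $K_\ell^\dagger$ are incoherent). For $1\le m\le d$ let $|\Psi_m\rangle=\frac1{\sqrt m}\sum_{i=1}^m|i\rangle$, $\Psi_m=|\Psi_m\rangle\langle\Psi_m|$, and define the fidelity of assisted distillation $$F_{A,\mathcal O}(\rho,m)=\sup\Big\{\operatorname{Tr}\Big[\Psi_m\sum_i p_i\Lambda_i(|\psi_i\rangle\langle\psi_i|)\Big]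 : \rho=\sum_i p_i|\psi_i\rangle\langle\psi_i|,\ \Lambda_i\in\mathcal O\Big\},$$ the supremum being over all finite decompositions of $\rho$ into pure states with probabilities $p_i$, and the one-shot assisted distillable coherence $$C_{A,\mathcal O}^{(1),\varepsilon}(\rho)=\log_2\max\{m\in\{1,\dots,d\} : F_{A,\mathcal O}(\rho,m)\ge 1-\varepsilon\}.$$ Let $F(\rho,\omega)=\|\sqrt\rho\sqrt\omega\|_1^2$, let $\mathcal B_\varepsilon(\rho)$ be the set of states $\omega$ on $\mathbb C^d$ with $F(\rho,\omega)\ge 1-\varepsilon$, let $\|\cdot\|_\infty$ be the largest singular value, and define the SDP quantity $$\widetilde C^{(1),\varepsilon}_{A,\mathcal O}(\rho)=\log_2\max\Big\{m\in\{1,\dots,d\} : \sup_{\omega \text{ a state},\ \|\Delta(\omega)\|_\infty\le 1/m}F(\rho,\omega)\ge 1-\varepsilon\Big\}.$$ Then $\min_{\omega\in\mathcal B_\varepsilon(\rho)}\|\Delta(\omega)\|_\infty$ is attained, and $$\widetilde C^{(1),\varepsilon}_{A,\mathcal O}(\rho)=\log_2\Big\lfloor 2^{-\log_2\min_{\omega\in\mathcal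 B_\varepsilon(\rho)}\|\Delta(\omega)\|_\infty}\Big\rfloor .$$ Moreover $$C_{A,\mathcal O}^{(1),\varepsilon}(\rho)\le\widetilde C^{(1),\varepsilon}_{A,\mathcal O}(\rho),$$ with equality if $d\le 3$. -/

import Mathlib

namespace AssistedCoherence

open scoped ComplexOrder MatrixOrder

noncomputable section

/-- Operators on the Hilbert space `ℂ^d`, as matrices in the fixed reference basis. -/
abbrev Op (d : ℕ) : Type := Matrix (Fin d) (Fin d) ℂ

/-- Density matrices (states). -/
def IsState {d : ℕ} (ρ : Op d) : Prop := ρ.PosSemidef ∧ ρ.trace = 1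

/-- The dephasing map `Δ(X) = ∑ i, |i⟩⟨i| X |i⟩⟨i|`. -/
def dephase {d : ℕ} (X : Op d) : Op d := Matrix.diagonal fun i => X i i

/-- Incoherent states: states `ω` with `ω = Δ(ω)`. -/
def IsIncoherent {d : ℕ} (ω : Op d) : Prop := IsState ω ∧ ω = dephase ω

/-- The Hilbert-Schmidt inner product `⟨X, Y⟩ = Tr (X† Y)`. -/
def hsInner {d : ℕ} (X Y : Op d) : ℂ := (X.conjTranspose * Y).trace

/-- The rank-one operator `|ψ⟩⟨ψ|`. -/
def proj {d : ℕ} (ψ : EuclideanSpace ℂ (Fin d)) : Op d :=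
  Matrix.of fun i j => ψ i * star (ψ j)

/-- The operator norm on `ℂ^d` (Schatten `∞`-norm, the largest singular value). -/
def opNorm {d : ℕ} (X : Op d) : ℝ := ‖Matrix.toEuclideanCLM (n := Fin d) (𝕜 := ℂ) X‖

/-- The trace norm (Schatten `1`-norm) `Tr √(X† X)`. -/
def traceNorm {d : ℕ} (X : Op d) : ℝ := (CFC.sqrt (X.conjTranspose * X)).trace.re

/-- The squared fidelity `F(ρ, σ) = ‖√ρ √σ‖₁²`. -/
def fidelity {d : ℕ} (ρ σ : Op d) : ℝ := traceNorm (CFC.sqrt ρ * CFC.sqrt σ) ^ 2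

/-- The amplification `id_n ⊗ Λ`, acting on operators on `ℂ^n ⊗ ℂ^d`. -/
def amplify {d : ℕ} (n : ℕ) (Λ : Op d →ₗ[ℂ] Op d)
    (X : Matrix (Fin n × Fin d) (Fin n × Fin d) ℂ) :
    Matrix (Fin n × Fin d) (Fin n × Fin d) ℂ :=
  Matrix.of fun r s => Λ (Matrix.of fun i j => X (r.1, i) (s.1, j)) r.2 s.2

/-- Quantum channels on `ℂ^d`: completely positive trace-preserving linear maps. -/
def IsChannel {d : ℕ} (Λ : Op d →ₗ[ℂ] Op d) : Prop :=
  (∀ (n : ℕ) (X : Matrix (Fin n × Fin d) (Fin n × Fin d) ℂ),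
    X.PosSemidef → (amplify n Λ X).PosSemidef) ∧
  ∀ X : Op d, (Λ X).trace = X.trace

/-- `{K_ℓ}` is a Kraus decomposition of `Λ`: `Λ(X) = ∑ ℓ, K_ℓ X K_ℓ†`. -/
def IsKraus {d n : ℕ} (Λ : Op d →ₗ[ℂ] Op d) (K : Fin n → Op d) : Prop :=
  ∀ X : Op d, Λ X = ∑ l, K l * X * (K l).conjTranspose

/-- Incoherent operators: every incoherent state `ρ` is mapped to an incoherent state
`K ρ K† / Tr (K ρ K†)`, whenever this outcome has nonzero probability. -/
def IsIncoherentOp {d : ℕ} (K : Op d) : Prop :=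
  ∀ ρ : Op d, IsIncoherent ρ → (K * ρ * K.conjTranspose).trace ≠ 0 →
    IsIncoherent ((K * ρ * K.conjTranspose).trace⁻¹ • (K * ρ * K.conjTranspose))

/-- The four classes of free operations. -/
inductive FreeClass : Type
  /-- maximally incoherent operations (MIO) -/
  | maximallyIncoherent
  /-- dephasing-covariant incoherent operations (DIO) -/
  | dephasingCovariant
  /-- incoherent operations -/
  | incoherent
  /-- strictly incoherent operations (SIO) -/
  | strictlyIncoherent

/-- Membership of a linear map in one of the four classes of free operations. -/
def FreeClass.Mem {d : ℕ} (O : FreeClass) (Λ : Op d →ₗ[ℂ] Op d) : Prop :=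
  match O with
  | .maximallyIncoherent => IsChannel Λ ∧ ∀ ρ : Op d, IsIncoherent ρ → IsIncoherent (Λ ρ)
  | .dephasingCovariant => IsChannel Λ ∧ ∀ X : Op d, dephase (Λ X) = Λ (dephase X)
  | .incoherent => IsChannel Λ ∧ ∃ (n : ℕ) (K : Fin n → Op d),
      IsKraus Λ K ∧ ∀ l, IsIncoherentOp (K l)
  | .strictlyIncoherent => IsChannel Λ ∧ ∃ (n : ℕ) (K : Fin n → Op d),
      IsKraus Λ K ∧ ∀ l, IsIncoherentOp (K l) ∧ IsIncoherentOp (K l).conjTranspose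

/-- The vector `|Ψ_m⟩ = ∑_{i < m} |i⟩ / √m` in the reference basis of `ℂ^d`
(used for `1 ≤ m ≤ d`). -/
def maxCohVec (d m : ℕ) : EuclideanSpace ℂ (Fin d) :=
  WithLp.toLp 2 fun i => if (i : ℕ) < m then ((1 / Real.sqrt m : ℝ) : ℂ) else 0

/-- The maximally coherent state `Ψ_m = |Ψ_m⟩⟨Ψ_m|`. -/
def maxCoh (d m : ℕ) : Op d := proj (maxCohVec d m)

/-- `ρ = ∑ i, p_i |ψ_i⟩⟨ψ_i|` is a (finite) pure-state decomposition of `ρ`. -/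
def IsPureDecomposition {d n : ℕ} (ρ : Op d) (p : Fin n → ℝ)
    (ψ : Fin n → EuclideanSpace ℂ (Fin d)) : Prop :=
  (∀ i, 0 ≤ p i) ∧ ∑ i, p i = 1 ∧ (∀ i, ‖ψ i‖ = 1) ∧ ρ = ∑ i, (p i : ℂ) • proj (ψ i)

/-- The average fidelity of assisted distillation `F_{A,O}(ρ, m)`: the best value of
`⟨∑ i, p_i Λ_i(ψ_i), Ψ_m⟩` over all pure-state decompositions of `ρ` and all `Λ_i ∈ O`. -/
def assistedFidelity {d : ℕ} (O : FreeClass) (ρ : Op d) (m : ℕ) : ℝ :=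
  sSup {x : ℝ | ∃ (n : ℕ) (p : Fin n → ℝ) (ψ : Fin n → EuclideanSpace ℂ (Fin d))
    (Λ : Fin n → (Op d →ₗ[ℂ] Op d)),
    IsPureDecomposition ρ p ψ ∧ (∀ i, O.Mem (Λ i)) ∧
    x = (hsInner (∑ i, (p i : ℂ) • Λ i (proj (ψ i))) (maxCoh d m)).re}

/-- The one-shot assisted distillable coherence
`C_{A,O}^{(1),ε}(ρ) = log₂ max {m | F_{A,O}(ρ, m) ≥ 1 - ε}`; here `1 ≤ m ≤ d`, so that `Ψ_m`
is a state of `ℂ^d`. -/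
def assistedRate {d : ℕ} (O : FreeClass) (ε : ℝ) (ρ : Op d) : ℝ :=
  Real.logb 2
    ((sSup {m : ℕ | 1 ≤ m ∧ m ≤ d ∧ 1 - ε ≤ assistedFidelity O ρ m} : ℕ) : ℝ)

/-- The set of states `ω` with `‖Δ(ω)‖_∞ ≤ 1 / m`. -/
def relaxedSet (d m : ℕ) : Set (Op d) := {ω | IsState ω ∧ opNorm (dephase ω) ≤ 1 / (m : ℝ)}

/-- The relaxed fidelity: the best value of `F(ρ, ω)` over states `ω` with
`‖Δ(ω)‖_∞ ≤ 1 / m`. -/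
def sdpFidelity {d : ℕ} (ρ : Op d) (m : ℕ) : ℝ := sSup (fidelity ρ '' relaxedSet d m)

/-- The relaxation of the rate, `log₂ max {m | sdpFidelity ρ m ≥ 1 - ε}`. -/
def sdpRate {d : ℕ} (ε : ℝ) (ρ : Op d) : ℝ :=
  Real.logb 2 ((sSup {m : ℕ | 1 ≤ m ∧ m ≤ d ∧ 1 - ε ≤ sdpFidelity ρ m} : ℕ) : ℝ)

/-- The ball `B_ε(ρ)` of states `ω` with `F(ρ, ω) ≥ 1 - ε`. -/
def fidelityBall {d : ℕ} (ε : ℝ) (ρ : Op d) : Set (Op d) :=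
  {ω | IsState ω ∧ 1 - ε ≤ fidelity ρ ω}

/-- The shorthand `logfloor x = log₂ ⌊2 ^ x⌋`. -/
def logFloor (x : ℝ) : ℝ := Real.logb 2 ((⌊(2 : ℝ) ^ x⌋₊ : ℕ) : ℝ)

end

end AssistedCoherence

/-! Everything reduces to comparing `assistedFidelity` with `sdpFidelity` for each fixed `m`, with
Uhlmann's theorem in matrix form as the bridge: if `A Aᴴ = ρ` and `B Bᴴ = ω`, then `Re Tr (Aᴴ B) ≤
√F(ρ, ω)`, with equality for a suitable `A` when `ω` is invertible. The columns of such an `A` are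
exactly an (unnormalised) pure-state decomposition of `ρ`.

Upper bound (`le_sdpFidelity_of_decomposition`): pull `Ψ_m` back to the effects `W_i = Λ_i*(Ψ_m)`.
They satisfy `0 ≤ W_i ≤ 1` and have diagonal entries at most `1/m`, because `Λ_i` keeps basis states
incoherent. If `T` is the average fidelity, the columns `√(p_i/T) W_i ψ_i` form a `B` with `Tr (Aᴴ
B) = √T`, whose `B Bᴴ` has trace at most 1 and diagonal at most `1/m`. Adding diagonal mass makes it
a state of `relaxedSet`, so Uhlmann gives `T ≤ sdpFidelity`.

Tightness for `d ≤ 3` (`sdpFidelity_le_assistedFidelity`): a state of rank at least two admits a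
four-dimensional real space of Hermitian perturbations on two independent range vectors, and only `d
< 4` real conditions make the diagonal vanish. Hence extreme points of `relaxedSet` are pure, and by
Krein-Milman its states are limits of mixtures of pure `η_i` with populations at most `1/m`.
Birkhoff's theorem turns each `η_i` into `Ψ_m` by monomial Kraus operators, which are free in all
four classes. Uhlmann's optimal decomposition of `ρ` and Cauchy-Schwarz then attain `F(ρ, ω)`.

The closed form of the SDP rate is compactness of the fidelity ball together with `m ≤ 1/κ ↔ m ≤
⌊1/κ⌋`. -/

namespace AssistedCoherence

open scoped ComplexOrder MatrixOrder
open Matrix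

/-! ### Matrix square roots and polar decomposition. -/

section
open scoped Matrix.Norms.L2Operator
theorem continuousOn_sqrt_posSemidef {d : ℕ} :
    ContinuousOn (fun X : Op d => CFC.sqrt X) {X | X.PosSemidef} := by
  unfold CFC.sqrt
  exact ContinuousOn.cfcₙ_nnreal_of_mem_nhdsSet (s := Set.univ) _ Filter.univ_mem continuousOn_id
    (fun X hX => Matrix.PosSemidef.nonneg hX) (by fun_prop) (by simp)
end

/-- The columns of `Y` are orthogonal with norms `|s i|`. Rescaling the nonzero ones gives an
orthonormal family, which extends to a basis; the added vectors are multiplied by `s i = 0`. -/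
theorem exists_unitary_mul_diagonal {d : ℕ} {Y : Op d} {s : Fin d → ℝ}
    (h : Yᴴ * Y = diagonal fun i => ((s i ^ 2 : ℝ) : ℂ)) :
    ∃ B : Op d, Bᴴ * B = 1 ∧ Y = B * diagonal fun i => (s i : ℂ) := by
  have hYY : ∀ i j, ∑ k, star (Y k i) * Y k j = if i = j then ((s i ^ 2 : ℝ) : ℂ) else 0 := by
    intro i j
    have := congrFun (congrFun h i) j
    simpa [mul_apply, diagonal_apply] using this
  let v : Fin d → EuclideanSpace ℂ (Fin d) := fun i => WithLp.toLp 2 fun k => (s i : ℂ)⁻¹ * Y k i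
  have hv : Orthonormal ℂ (Set.domRestrict {i | s i ≠ 0} v) := by
    rw [orthonormal_iff_ite]
    rintro ⟨i, hi⟩ ⟨j, hj⟩
    have hi' : (s i : ℂ) ≠ 0 := by simpa using hi
    have hj' : (s j : ℂ) ≠ 0 := by simpa using hj
    have e : inner ℂ (v i) (v j) = (s i : ℂ)⁻¹ * (s j : ℂ)⁻¹ * ∑ k, star (Y k i) * Y k j := by
      simp only [PiLp.inner_apply, v, Finset.mul_sum]
      refine Finset.sum_congr rfl fun k _ => ?_
      simp; ring
    simp only [Set.domRestrict_apply, Subtype.mk.injEq]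
    rw [e, hYY]
    by_cases hij : i = j
    · subst hij
      simp only [if_true]; push_cast; field_simp
    · simp [hij]
  obtain ⟨b, hb⟩ := hv.exists_orthonormalBasis_extension_of_card_eq (by simp)
  refine ⟨of fun k i => b i k, ?_, ?_⟩
  · ext i j
    have := orthonormal_iff_ite.1 b.orthonormal i j
    rw [PiLp.inner_apply] at this
    simp only [mul_apply, one_apply, conjTranspose_apply, of_apply]
    rw [← this]
    exact Finset.sum_congr rfl fun k _ => by simp [mul_comm]
  · ext k i
    rw [mul_diagonal, of_apply]
    by_cases hi : s i = 0
    · have h0 := hYY i i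
      simp only [if_true, hi] at h0
      have h1 : ∑ k, ‖Y k i‖ ^ 2 = 0 := by
        have : ((∑ k, ‖Y k i‖ ^ 2 : ℝ) : ℂ) = 0 := by
          push_cast
          rw [← Complex.ofReal_zero]
          simpa [← Complex.conj_mul'] using h0
        exact_mod_cast this
      have h2 := (Finset.sum_eq_zero_iff_of_nonneg (fun k _ => by positivity)).1 h1 k (Finset.mem_univ k)
      have : Y k i = 0 := by simpa using h2
      simp [hi, this]
    · rw [hb i hi]
      have hi' : (s i : ℂ) ≠ 0 := by simpa using hi
      simp [v]; field_simp

/-- Polar decomposition of a square matrix, with a unitary factor. -/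
theorem exists_polar {d : ℕ} (X : Op d) :
    ∃ U : Op d, Uᴴ * U = 1 ∧ X = U * CFC.sqrt (Xᴴ * X) := by
  set P := CFC.sqrt (Xᴴ * X) with hPdef
  have hP : P.PosSemidef := (CFC.sqrt_nonneg _).posSemidef
  have hPP : P * P = Xᴴ * X :=
    CFC.sqrt_mul_sqrt_self _ (posSemidef_conjTranspose_mul_self X).nonneg
  let V : Op d := hP.isHermitian.eigenvectorUnitary
  let s := hP.isHermitian.eigenvalues
  have hV : Vᴴ * V = 1 := (mem_unitaryGroup_iff'.1 hP.isHermitian.eigenvectorUnitary.2)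
  have hV' : V * Vᴴ = 1 := mul_eq_one_comm.1 hV
  have hS : P = V * diagonal (fun i => (s i : ℂ)) * Vᴴ := by
    have := hP.isHermitian.spectral_theorem
    rw [Unitary.conjStarAlgAut_apply] at this
    exact this
  -- In the eigenbasis `V` of `√(Xᴴ X)` the columns of `X V` are orthogonal, so no invertibility of
  -- `X` is needed.
  obtain ⟨B, hB, hY⟩ := exists_unitary_mul_diagonal (Y := X * V) (s := s) (by
    rw [conjTranspose_mul, Matrix.mul_assoc, ← Matrix.mul_assoc Xᴴ, ← hPP, hS]
    simp only [Matrix.mul_assoc, hV, Matrix.mul_one]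
    rw [← Matrix.mul_assoc Vᴴ V, hV, Matrix.one_mul, ← Matrix.mul_assoc Vᴴ V, hV, Matrix.one_mul,
      diagonal_mul_diagonal]
    congr 1; ext i; push_cast; ring)
  refine ⟨B * Vᴴ, ?_, ?_⟩
  · rw [conjTranspose_mul, conjTranspose_conjTranspose, Matrix.mul_assoc, ← Matrix.mul_assoc Bᴴ, hB,
      Matrix.one_mul, hV']
  · rw [hS]
    simp only [Matrix.mul_assoc]
    rw [← Matrix.mul_assoc Vᴴ V, hV, Matrix.one_mul, ← Matrix.mul_assoc B, ← hY, Matrix.mul_assoc,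
      hV', Matrix.mul_one]

/-! ### Uhlmann's theorem for the fidelity. -/

theorem two_mul_re_trace_le {m n : Type*} [Fintype m] [Fintype n] (Y Z : Matrix m n ℂ) :
    2 * (Yᴴ * Z).trace.re ≤ (Yᴴ * Y).trace.re + (Zᴴ * Z).trace.re := by
  have h := (Complex.le_def.1 (posSemidef_conjTranspose_mul_self (Y - Z)).trace_nonneg).1
  have e : (Zᴴ * Y).trace.re = (Yᴴ * Z).trace.re := by
    rw [← conjTranspose_conjTranspose Y, ← conjTranspose_mul, trace_conjTranspose]
    simp
  rw [conjTranspose_sub, Matrix.sub_mul, Matrix.mul_sub, Matrix.mul_sub] at h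
  simp only [trace_sub, Complex.sub_re, Complex.zero_re] at h
  linarith

theorem exists_coisometry {d : ℕ} {ι : Type*} [Fintype ι] {B : Matrix (Fin d) ι ℂ}
    (h : (B * Bᴴ).PosDef) : ∃ V : Matrix (Fin d) ι ℂ, V * Vᴴ = 1 ∧ B = CFC.sqrt (B * Bᴴ) * V := by
  set S := CFC.sqrt (B * Bᴴ) with hS
  have hSp : S.PosSemidef := (CFC.sqrt_nonneg _).posSemidef
  have hSS : S * S = B * Bᴴ := CFC.sqrt_mul_sqrt_self _ h.posSemidef.nonneg
  have hdet : IsUnit S.det := by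
    have h1 : IsUnit (S * S).det := by rw [hSS]; exact (isUnit_iff_isUnit_det _).1 h.isUnit
    rw [det_mul] at h1
    exact isUnit_of_mul_isUnit_left h1
  refine ⟨S⁻¹ * B, ?_, by rw [mul_nonsing_inv_cancel_left _ _ hdet]⟩
  rw [conjTranspose_mul, conjTranspose_nonsing_inv, hSp.isHermitian.eq, Matrix.mul_assoc,
    ← Matrix.mul_assoc B, ← hSS, Matrix.mul_assoc, mul_nonsing_inv _ hdet, Matrix.mul_one,
    nonsing_inv_mul _ hdet]

theorem re_trace_le_traceNorm_of_posDef {d : ℕ} {ι : Type*} [Fintype ι]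
    {A B : Matrix (Fin d) ι ℂ} (hA : (A * Aᴴ).PosDef) (hB : (B * Bᴴ).PosDef) :
    (Aᴴ * B).trace.re ≤ traceNorm (CFC.sqrt (A * Aᴴ) * CFC.sqrt (B * Bᴴ)) := by
  obtain ⟨V, hV, hAV⟩ := exists_coisometry hA
  obtain ⟨W, hW, hBW⟩ := exists_coisometry hB
  set S := CFC.sqrt (A * Aᴴ) with hS
  set R := CFC.sqrt (B * Bᴴ) with hR
  have hSp : S.PosSemidef := (CFC.sqrt_nonneg _).posSemidef
  obtain ⟨U, hU, hX⟩ := exists_polar (S * R)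
  unfold traceNorm
  set P := CFC.sqrt ((S * R)ᴴ * (S * R))
  have hP : P.PosSemidef := (CFC.sqrt_nonneg _).posSemidef
  set Q := CFC.sqrt P
  have hQ : Q.PosSemidef := (CFC.sqrt_nonneg _).posSemidef
  have hQQ : Q * Q = P := CFC.sqrt_mul_sqrt_self _ hP.nonneg
  have hUU : U * Uᴴ = 1 := mul_eq_one_comm.1 hU
  -- With `A = S V`, `B = R W` and `S R = U Q²`, the trace of `Aᴴ B` is the inner product of these
  -- two matrices. Both have squared Frobenius norm `Tr P`, the trace norm sought.
  have key := two_mul_re_trace_le (Q * Uᴴ * V) (Q * W)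
  have e1 : (Q * Uᴴ * V)ᴴ * (Q * W) = Aᴴ * B := by
    rw [hAV, hBW]
    simp only [conjTranspose_mul, conjTranspose_conjTranspose, hQ.isHermitian.eq, hSp.isHermitian.eq]
    have : Vᴴ * S * (R * W) = Vᴴ * (S * R) * W := by simp only [Matrix.mul_assoc]
    rw [this, hX, ← hQQ]
    simp only [Matrix.mul_assoc]
  have e2 : ((Q * Uᴴ * V)ᴴ * (Q * Uᴴ * V)).trace = P.trace := by
    rw [trace_mul_comm]
    simp only [conjTranspose_mul, conjTranspose_conjTranspose, hQ.isHermitian.eq]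
    have : Q * Uᴴ * V * (Vᴴ * (U * Q)) = Q * (Uᴴ * (V * Vᴴ) * U) * Q := by
      simp only [Matrix.mul_assoc]
    rw [this, hV, Matrix.mul_one, hU, Matrix.mul_one, hQQ]
  have e3 : ((Q * W)ᴴ * (Q * W)).trace = P.trace := by
    rw [trace_mul_comm]
    simp only [conjTranspose_mul, hQ.isHermitian.eq]
    have : Q * W * (Wᴴ * Q) = Q * (W * Wᴴ) * Q := by
      simp only [Matrix.mul_assoc]
    rw [this, hW, Matrix.mul_one, hQQ]
  rw [e1, e2, e3] at key
  linarith

/-- Equality in Uhlmann's inequality is attained for every decomposition `B B†` of a positive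
definite matrix. -/
theorem exists_mul_conjTranspose_eq_of_posDef {d : ℕ} {ι : Type*} [Fintype ι] {ρ : Op d}
    (hρ : ρ.PosSemidef) {B : Matrix (Fin d) ι ℂ} (hB : (B * Bᴴ).PosDef) :
    ∃ A : Matrix (Fin d) ι ℂ, A * Aᴴ = ρ ∧
      (Aᴴ * B).trace.re = traceNorm (CFC.sqrt ρ * CFC.sqrt (B * Bᴴ)) := by
  obtain ⟨W, hW, hBW⟩ := exists_coisometry hB
  set S := CFC.sqrt ρ with hS
  set R := CFC.sqrt (B * Bᴴ) with hR
  have hSp : S.PosSemidef := (CFC.sqrt_nonneg _).posSemidef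
  have hSS : S * S = ρ := CFC.sqrt_mul_sqrt_self _ hρ.nonneg
  obtain ⟨U, hU, hX⟩ := exists_polar (S * R)
  unfold traceNorm
  set P := CFC.sqrt ((S * R)ᴴ * (S * R))
  have hUU : U * Uᴴ = 1 := mul_eq_one_comm.1 hU
  -- The polar unitary `U` of `√ρ R` aligns the two factors, so the trace collapses to `Tr (Uᴴ S
  -- R)`, the trace norm.
  refine ⟨S * U * W, ?_, ?_⟩
  · simp only [conjTranspose_mul, hSp.isHermitian.eq]
    have : S * U * W * (Wᴴ * (Uᴴ * S)) = S * (U * (W * Wᴴ) * Uᴴ) * S := by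
      simp only [Matrix.mul_assoc]
    rw [this, hW, Matrix.mul_one, hUU, Matrix.mul_one, hSS]
  · rw [hBW]
    simp only [conjTranspose_mul, hSp.isHermitian.eq]
    have : Wᴴ * (Uᴴ * S) * (R * W) = Wᴴ * (Uᴴ * (S * R) * W) := by simp only [Matrix.mul_assoc]
    rw [this, hX, ← Matrix.mul_assoc Uᴴ, hU, Matrix.one_mul, trace_mul_comm, Matrix.mul_assoc, hW,
      Matrix.mul_one]

theorem continuous_traceNorm {d : ℕ} : Continuous (traceNorm : Op d → ℝ) := by
  have h : Continuous fun X : Op d => CFC.sqrt (Xᴴ * X) :=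
    continuousOn_sqrt_posSemidef.comp_continuous (by fun_prop)
      fun X => posSemidef_conjTranspose_mul_self X
  exact Complex.continuous_re.comp h.matrix_trace

theorem continuousOn_fidelity {d : ℕ} (ρ : Op d) :
    ContinuousOn (fidelity ρ) {X | X.PosSemidef} := by
  unfold fidelity
  exact (continuous_traceNorm.comp_continuousOn
    (continuousOn_const.mul continuousOn_sqrt_posSemidef)).pow 2

/-- Uhlmann's inequality: any `A`, `B` with `A A† = ρ` and `B B† = ω` satisfy
`Re Tr (A† B) ≤ ‖√ρ √ω‖₁`. -/
theorem re_trace_le_traceNorm {d : ℕ} {ι : Type*} [Fintype ι] (A B : Matrix (Fin d) ι ℂ) :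
    (Aᴴ * B).trace.re ≤ traceNorm (CFC.sqrt (A * Aᴴ) * CFC.sqrt (B * Bᴴ)) := by
  -- Appending the block `c • 1` makes both Gram matrices positive definite and can only increase
  -- the real part of the trace. The general case follows as `c → 0⁺`.
  have hcols : ∀ (C : Matrix (Fin d) ι ℂ) (c : ℝ),
      fromCols C ((c : ℂ) • (1 : Op d)) * (fromCols C ((c : ℂ) • (1 : Op d)))ᴴ
        = C * Cᴴ + ((c ^ 2 : ℝ) : ℂ) • (1 : Op d) := by
    intro C c
    rw [conjTranspose_fromCols_eq_fromRows_conjTranspose, fromCols_mul_fromRows]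
    rw [conjTranspose_smul, conjTranspose_one, Matrix.smul_mul, Matrix.mul_smul, smul_smul,
      Matrix.one_mul]
    congr 2
    simp [sq]
  have hpos : ∀ (C : Matrix (Fin d) ι ℂ) (c : ℝ), 0 < c →
      (C * Cᴴ + ((c ^ 2 : ℝ) : ℂ) • (1 : Op d)).PosDef := by
    intro C c hc
    refine PosDef.posSemidef_add (posSemidef_self_mul_conjTranspose C) (PosDef.one.smul ?_)
    exact_mod_cast pow_pos hc 2
  have hcont : ∀ C : Matrix (Fin d) ι ℂ, Continuous fun c : ℝ =>
      CFC.sqrt (C * Cᴴ + ((c ^ 2 : ℝ) : ℂ) • (1 : Op d)) := by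
    intro C
    refine continuousOn_sqrt_posSemidef.comp_continuous (by fun_prop) fun c => ?_
    refine (posSemidef_self_mul_conjTranspose C).add (PosSemidef.one.smul ?_)
    exact_mod_cast sq_nonneg c
  have hle : ∀ c : ℝ, 0 < c → (Aᴴ * B).trace.re ≤
      traceNorm (CFC.sqrt (A * Aᴴ + ((c ^ 2 : ℝ) : ℂ) • (1 : Op d)) *
        CFC.sqrt (B * Bᴴ + ((c ^ 2 : ℝ) : ℂ) • (1 : Op d))) := by
    intro c hc
    have h := re_trace_le_traceNorm_of_posDef (A := fromCols A ((c : ℂ) • (1 : Op d)))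
      (B := fromCols B ((c : ℂ) • (1 : Op d))) (by rw [hcols]; exact hpos _ c hc)
      (by rw [hcols]; exact hpos _ c hc)
    rw [hcols, hcols, conjTranspose_fromCols_eq_fromRows_conjTranspose] at h
    refine le_trans ?_ h
    have h0 : 0 ≤ (((c : ℂ) • (1 : Op d))ᴴ * ((c : ℂ) • (1 : Op d))).trace.re :=
      (Complex.le_def.1 (posSemidef_conjTranspose_mul_self _).trace_nonneg).1
    rw [fromRows_mul_fromCols]
    simp only [trace, diag_apply, Fintype.sum_sum_type, fromBlocks_apply₁₁, fromBlocks_apply₂₂,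
      Complex.add_re] at h0 ⊢
    linarith
  have hlim := (continuous_traceNorm.comp ((hcont A).mul (hcont B))).tendsto 0
  have := ge_of_tendsto (hlim.mono_left (nhdsWithin_le_nhds (s := Set.Ioi 0)))
    (by filter_upwards [self_mem_nhdsWithin] with c hc using hle c hc)
  simpa using this

/-! ### Compactness of the sets of states and the closed form of the SDP rate. -/

theorem re_diag_nonneg {d : ℕ} {ω : Op d} (h : ω.PosSemidef) (i : Fin d) :
    0 ≤ (ω i i).re :=
  (Complex.le_def.1 h.diag_nonneg).1

theorem norm_diag_of_posSemidef {d : ℕ} {ω : Op d} (h : ω.PosSemidef) (i : Fin d) :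
    ‖ω i i‖ = (ω i i).re := by
  rw [Complex.norm_def, Complex.normSq_apply, ← (Complex.le_def.1 h.diag_nonneg).2]
  simpa using Real.sqrt_mul_self (re_diag_nonneg h i)

theorem opNorm_dephase {d : ℕ} (X : Op d) : opNorm (dephase X) = ‖fun i => X i i‖ := by
  unfold opNorm dephase
  rw [← Matrix.cstar_norm_def, Matrix.l2_opNorm_diagonal]

theorem opNorm_dephase_le_iff {d : ℕ} {ω : Op d} (h : ω.PosSemidef) {r : ℝ} (hr : 0 ≤ r) :
    opNorm (dephase ω) ≤ r ↔ ∀ i, (ω i i).re ≤ r := by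
  rw [opNorm_dephase, pi_norm_le_iff_of_nonneg hr]
  simp only [norm_diag_of_posSemidef h]

theorem IsState.sum_re_diag {d : ℕ} {ω : Op d} (h : IsState ω) : ∑ i, (ω i i).re = 1 := by
  have := congrArg Complex.re h.2
  simpa [trace] using this

theorem continuous_opNorm_dephase {d : ℕ} :
    Continuous fun X : Op d => opNorm (dephase X) := by
  simp only [opNorm_dephase]
  fun_prop

/-- States are the continuous image, under `S ↦ S Sᴴ`, of the unit Frobenius sphere. -/
theorem isCompact_isState {d : ℕ} : IsCompact {ω : Op d | IsState ω} := by
  have hK : IsCompact {S : Fin d → Fin d → ℂ | ∑ i, ∑ j, ‖S i j‖ ^ 2 = 1} := by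
    have hpi : IsCompact (Set.univ.pi fun _ : Fin d => Set.univ.pi fun _ : Fin d =>
        Metric.closedBall (0 : ℂ) 1) :=
      isCompact_univ_pi fun _ => isCompact_univ_pi fun _ => isCompact_closedBall 0 1
    refine hpi.of_isClosed_subset (isClosed_eq (by fun_prop) continuous_const) ?_
    intro S hS i _ j _
    have h1 : ‖S i j‖ ^ 2 ≤ 1 := by
      rw [← (show ∑ i, ∑ j, ‖S i j‖ ^ 2 = 1 from hS)]
      refine (Finset.single_le_sum (f := fun j => ‖S i j‖ ^ 2) (fun _ _ => by positivity)
        (Finset.mem_univ j)).trans ?_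
      exact Finset.single_le_sum (f := fun i => ∑ j, ‖S i j‖ ^ 2) (fun _ _ => by positivity)
        (Finset.mem_univ i)
    simpa using abs_le_of_sq_le_sq' (by simpa using h1) zero_le_one |>.2
  have himg : {ω : Op d | IsState ω} =
      (fun S : Fin d → Fin d → ℂ => (of S : Op d) * (of S : Op d)ᴴ) ''
        {S | ∑ i, ∑ j, ‖S i j‖ ^ 2 = 1} := by
    have htr : ∀ S : Op d, (S * Sᴴ).trace = ((∑ i, ∑ j, ‖S i j‖ ^ 2 : ℝ) : ℂ) := by
      intro S
      simp [trace, mul_apply, Complex.mul_conj']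
    ext ω
    constructor
    · rintro ⟨hω, htrω⟩
      have hS : (CFC.sqrt ω).PosSemidef := (CFC.sqrt_nonneg _).posSemidef
      have hSS : CFC.sqrt ω * (CFC.sqrt ω)ᴴ = ω := by
        rw [hS.isHermitian.eq]; exact CFC.sqrt_mul_sqrt_self _ hω.nonneg
      refine ⟨fun i j => CFC.sqrt ω i j, ?_, hSS⟩
      have := htr (CFC.sqrt ω)
      rw [hSS, htrω] at this
      rw [Set.mem_ofPred_eq]
      exact_mod_cast this.symm
    · rintro ⟨S, hS, rfl⟩
      refine ⟨posSemidef_self_mul_conjTranspose _, ?_⟩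
      rw [htr]
      exact_mod_cast hS
  rw [himg]
  refine hK.image ?_
  have : Continuous fun S : Fin d → Fin d → ℂ => (of S : Op d) := continuous_id
  exact this.matrix_mul this.matrix_conjTranspose

theorem fidelity_nonneg {d : ℕ} (ρ ω : Op d) : 0 ≤ fidelity ρ ω := sq_nonneg _

theorem fidelity_self {d : ℕ} {ρ : Op d} (hρ : IsState ρ) : fidelity ρ ρ = 1 := by
  unfold fidelity traceNorm
  rw [CFC.sqrt_mul_sqrt_self _ hρ.1.nonneg, hρ.1.isHermitian.eq, CFC.sqrt_mul_self _ hρ.1.nonneg,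
    hρ.2]
  simp

theorem continuousOn_fidelity_isState {d : ℕ} (ρ : Op d) :
    ContinuousOn (fidelity ρ) {ω | IsState ω} :=
  (continuousOn_fidelity ρ).mono fun _ h => h.1

theorem isCompact_fidelityBall {d : ℕ} (ε : ℝ) (ρ : Op d) : IsCompact (fidelityBall ε ρ) := by
  obtain ⟨u, hu, hu'⟩ := continuousOn_iff_isClosed.1 (continuousOn_fidelity_isState ρ)
    (Set.Ici (1 - ε)) isClosed_Ici
  have : fidelityBall ε ρ = {ω | IsState ω} ∩ u := by
    rw [Set.inter_comm, ← hu']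
    ext ω
    exact and_comm
  rw [this]
  exact isCompact_isState.inter_right hu

theorem isCompact_relaxedSet (d m : ℕ) : IsCompact (relaxedSet d m) :=
  isCompact_isState.inter_right (isClosed_le continuous_opNorm_dephase continuous_const)

theorem isState_maximallyMixed {d : ℕ} (hd : d ≠ 0) : IsState ((d : ℂ)⁻¹ • (1 : Op d)) := by
  refine ⟨PosSemidef.one.smul (by positivity), ?_⟩
  have : (d : ℂ) ≠ 0 := by exact_mod_cast hd
  simp [this]

theorem mem_relaxedSet_iff {d m : ℕ} {ω : Op d} :
    ω ∈ relaxedSet d m ↔ IsState ω ∧ ∀ i, (ω i i).re ≤ 1 / (m : ℝ) :=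
  and_congr_right fun h => opNorm_dephase_le_iff h.1 (by positivity)

theorem maximallyMixed_mem_relaxedSet {d m : ℕ} (hm : 1 ≤ m) (hmd : m ≤ d) :
    (d : ℂ)⁻¹ • (1 : Op d) ∈ relaxedSet d m := by
  refine mem_relaxedSet_iff.2 ⟨isState_maximallyMixed (by omega), fun i => ?_⟩
  have : ((d : ℂ)⁻¹).re = 1 / (d : ℝ) := by
    rw [one_div, ← Complex.ofReal_natCast, ← Complex.ofReal_inv, Complex.ofReal_re]
  simp only [Matrix.smul_apply, one_apply_eq, smul_eq_mul, mul_one]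
  rw [this]
  have : (0 : ℝ) < m := by exact_mod_cast hm
  gcongr

theorem exists_fidelity_eq_sdpFidelity {d m : ℕ} (ρ : Op d) (hm : 1 ≤ m) (hmd : m ≤ d) :
    ∃ ω ∈ relaxedSet d m, sdpFidelity ρ m = fidelity ρ ω :=
  (isCompact_relaxedSet d m).exists_sSup_image_eq ⟨_, maximallyMixed_mem_relaxedSet hm hmd⟩
    ((continuousOn_fidelity_isState ρ).mono fun _ h => h.1)

theorem fidelity_le_sdpFidelity {d m : ℕ} (ρ : Op d) {ω : Op d} (hω : ω ∈ relaxedSet d m) :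
    fidelity ρ ω ≤ sdpFidelity ρ m :=
  le_csSup ((isCompact_relaxedSet d m).image_of_continuousOn
    ((continuousOn_fidelity_isState ρ).mono fun _ h => h.1)).bddAbove ⟨ω, hω, rfl⟩

theorem le_sdpFidelity_iff {d m : ℕ} (ρ : Op d) (hm : 1 ≤ m) (hmd : m ≤ d) {r : ℝ} :
    r ≤ sdpFidelity ρ m ↔ ∃ ω ∈ relaxedSet d m, r ≤ fidelity ρ ω := by
  constructor
  · intro h
    obtain ⟨ω, hω, e⟩ := exists_fidelity_eq_sdpFidelity ρ hm hmd
    exact ⟨ω, hω, e ▸ h⟩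
  · rintro ⟨ω, hω, h⟩
    exact h.trans (fidelity_le_sdpFidelity ρ hω)

theorem IsState.dim_pos {d : ℕ} {ρ : Op d} (hρ : IsState ρ) : 1 ≤ d := by
  rcases Nat.eq_zero_or_pos d with rfl | h
  · simpa [trace] using hρ.2
  · exact h

theorem one_div_dim_le_opNorm_dephase {d : ℕ} {ω : Op d} (hω : IsState ω) :
    1 / (d : ℝ) ≤ opNorm (dephase ω) := by
  have hd : (0 : ℝ) < d := by exact_mod_cast hω.dim_pos
  have h := (opNorm_dephase_le_iff hω.1 (norm_nonneg _)).1 (le_refl (opNorm (dephase ω)))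
  rw [div_le_iff₀ hd, ← hω.sum_re_diag, mul_comm]
  calc ∑ i, (ω i i).re ≤ ∑ _i : Fin d, opNorm (dephase ω) := Finset.sum_le_sum fun i _ => h i
    _ = d * opNorm (dephase ω) := by simp

theorem opNorm_dephase_le_one {d : ℕ} {ω : Op d} (hω : IsState ω) :
    opNorm (dephase ω) ≤ 1 := by
  refine (opNorm_dephase_le_iff hω.1 zero_le_one).2 fun i => ?_
  rw [← hω.sum_re_diag]
  exact Finset.single_le_sum (f := fun i => (ω i i).re)
    (fun i _ => re_diag_nonneg hω.1 i) (Finset.mem_univ i)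

theorem exists_isLeast_and_sdpRate_eq {d : ℕ} {ρ : Op d} (hρ : IsState ρ) {ε : ℝ} (hε : 0 ≤ ε) :
    ∃ κ : ℝ, IsLeast ((fun ω => opNorm (dephase ω)) '' fidelityBall ε ρ) κ ∧
      sdpRate ε ρ = logFloor (-Real.logb 2 κ) := by
  have hne : (fidelityBall ε ρ).Nonempty := ⟨ρ, hρ, by rw [fidelity_self hρ]; linarith⟩
  obtain ⟨κ, hκ⟩ := ((isCompact_fidelityBall ε ρ).image continuous_opNorm_dephase).exists_isLeast
    (hne.image _)
  refine ⟨κ, hκ, ?_⟩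
  obtain ⟨ω₀, hω₀, hκω⟩ := hκ.1
  have hd : (0 : ℝ) < d := by exact_mod_cast hρ.dim_pos
  have hκd : 1 / (d : ℝ) ≤ κ := hκω ▸ one_div_dim_le_opNorm_dephase hω₀.1
  have hκ1 : κ ≤ 1 := hκω ▸ opNorm_dephase_le_one hω₀.1
  have hκ0 : 0 < κ := lt_of_lt_of_le (by positivity) hκd
  unfold sdpRate logFloor
  congr 2
  rw [← Real.logb_inv, Real.rpow_logb (by norm_num) (by norm_num) (by positivity)]
  -- Both sides ask for a state in the ball with diagonal at most `1/m`, that is `κ ≤ 1/m`. The cap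
  -- `m ≤ d` is then automatic, since `κ ≥ 1/d`.
  have hset : {m : ℕ | 1 ≤ m ∧ m ≤ d ∧ 1 - ε ≤ sdpFidelity ρ m} = Set.Icc 1 ⌊κ⁻¹⌋₊ := by
    ext m
    simp only [Set.mem_ofPred_eq, Set.mem_Icc]
    refine and_congr_right fun hm => ?_
    have hm0 : (0 : ℝ) < m := by exact_mod_cast hm
    rw [Nat.le_floor_iff (by positivity), le_inv_comm₀ hm0 hκ0]
    constructor
    · rintro ⟨hmd, h⟩
      obtain ⟨ω, hω, hF⟩ := (le_sdpFidelity_iff ρ hm hmd).1 h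
      rw [← one_div]
      exact (hκ.2 ⟨ω, ⟨hω.1, hF⟩, rfl⟩).trans hω.2
    · intro h
      have hmd : m ≤ d := by
        have h1 : 1 / (d : ℝ) ≤ 1 / m := hκd.trans (by rwa [one_div])
        exact_mod_cast (one_div_le_one_div hd hm0).1 h1
      exact ⟨hmd, (le_sdpFidelity_iff ρ hm hmd).2 ⟨ω₀, ⟨hω₀.1, by
        rw [one_div]; exact hκω.le.trans h⟩, hω₀.2⟩⟩
  rw [hset]
  refine csSup_Icc ?_
  rw [Nat.le_floor_iff (by positivity), Nat.cast_one]
  exact (one_le_inv₀ hκ0).2 hκ1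

/-! ### The upper bound: free channels, dual effects and the relaxed fidelity. -/

theorem IsChannel.map_posSemidef {d : ℕ} {Λ : Op d →ₗ[ℂ] Op d} (h : IsChannel Λ) {X : Op d}
    (hX : X.PosSemidef) : (Λ X).PosSemidef := by
  have h1 := h.1 1 (X.submatrix Prod.snd Prod.snd) (hX.submatrix _)
  exact h1.submatrix fun i => (0, i)

theorem IsChannel.map_isState {d : ℕ} {Λ : Op d →ₗ[ℂ] Op d} (h : IsChannel Λ) {X : Op d}
    (hX : IsState X) : IsState (Λ X) :=
  ⟨h.map_posSemidef hX.1, by rw [h.2, hX.2]⟩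

theorem dephase_sum {d : ℕ} {ι : Type*} (s : Finset ι) (X : ι → Op d) :
    dephase (∑ l ∈ s, X l) = ∑ l ∈ s, dephase (X l) := by
  ext i j
  by_cases h : i = j <;> simp [dephase, Matrix.sum_apply, h]

theorem dephase_smul {d : ℕ} (c : ℂ) (X : Op d) : dephase (c • X) = c • dephase X := by
  ext i j
  by_cases h : i = j <;> simp [dephase, h]

theorem IsIncoherentOp.dephase_conj {d : ℕ} {K : Op d} (hK : IsIncoherentOp K) {ρ : Op d}
    (hρ : IsIncoherent ρ) : K * ρ * Kᴴ = dephase (K * ρ * Kᴴ) := by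
  by_cases h : (K * ρ * Kᴴ).trace = 0
  · rw [(hρ.1.1.mul_mul_conjTranspose_same K).trace_eq_zero_iff.1 h]
    ext i j
    simp [dephase, diagonal_apply]
  · have := (hK ρ hρ h).2
    rw [dephase_smul] at this
    exact (smul_right_injective _ (inv_ne_zero h)) this

theorem FreeClass.Mem.isChannel {d : ℕ} {O : FreeClass} {Λ : Op d →ₗ[ℂ] Op d} (h : O.Mem Λ) :
    IsChannel Λ := by
  cases O <;> exact h.1

theorem isIncoherent_of_isKraus {d n : ℕ} {Λ : Op d →ₗ[ℂ] Op d} (h : IsChannel Λ)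
    {K : Fin n → Op d} (hΛ : IsKraus Λ K) (hK : ∀ l, IsIncoherentOp (K l)) {ρ : Op d}
    (hρ : IsIncoherent ρ) : IsIncoherent (Λ ρ) := by
  refine ⟨h.map_isState hρ.1, ?_⟩
  rw [hΛ, dephase_sum]
  exact Finset.sum_congr rfl fun l _ => (hK l).dephase_conj hρ

/-- All four classes lie in MIO; beyond being channels, this is all that the upper bound needs of
them. -/
theorem FreeClass.Mem.isIncoherent {d : ℕ} {O : FreeClass} {Λ : Op d →ₗ[ℂ] Op d} (h : O.Mem Λ)
    {ρ : Op d} (hρ : IsIncoherent ρ) : IsIncoherent (Λ ρ) := by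
  cases O
  · exact h.2 ρ hρ
  · exact ⟨h.1.map_isState hρ.1, by rw [h.2, ← hρ.2]⟩
  · obtain ⟨hc, n, K, hK, hI⟩ := h
    exact isIncoherent_of_isKraus hc hK hI hρ
  · obtain ⟨hc, n, K, hK, hI⟩ := h
    exact isIncoherent_of_isKraus hc hK (fun l => (hI l).1) hρ

theorem proj_eq_vecMulVec {d : ℕ} (ψ : EuclideanSpace ℂ (Fin d)) :
    proj ψ = vecMulVec ψ (star (ψ : Fin d → ℂ)) := rfl

theorem proj_posSemidef {d : ℕ} (ψ : EuclideanSpace ℂ (Fin d)) : (proj ψ).PosSemidef :=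
  posSemidef_vecMulVec_self_star _

theorem sum_sq_norm_eq_star_dotProduct {ι : Type*} [Fintype ι] (x : ι → ℂ) :
    ((∑ i, ‖x i‖ ^ 2 : ℝ) : ℂ) = star x ⬝ᵥ x := by
  simp [dotProduct, Complex.conj_mul']

theorem trace_proj {d : ℕ} (ψ : EuclideanSpace ℂ (Fin d)) :
    (proj ψ).trace = star (ψ : Fin d → ℂ) ⬝ᵥ ψ := by
  rw [proj_eq_vecMulVec, trace_vecMulVec, dotProduct_comm]

theorem isState_proj {d : ℕ} {ψ : EuclideanSpace ℂ (Fin d)} (h : ‖ψ‖ = 1) :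
    IsState (proj ψ) := by
  refine ⟨proj_posSemidef ψ, ?_⟩
  rw [trace_proj, ← sum_sq_norm_eq_star_dotProduct, ← EuclideanSpace.norm_sq_eq, h]
  simp

theorem norm_sq_star_dotProduct_le {ι : Type*} [Fintype ι] (x y : ι → ℂ) :
    ‖star x ⬝ᵥ y‖ ^ 2 ≤ (∑ i, ‖x i‖ ^ 2) * ∑ i, ‖y i‖ ^ 2 := by
  calc ‖star x ⬝ᵥ y‖ ^ 2 ≤ (∑ i, ‖x i‖ * ‖y i‖) ^ 2 := by
        refine pow_le_pow_left₀ (norm_nonneg _) ?_ 2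
        refine (norm_sum_le _ _).trans (le_of_eq (Finset.sum_congr rfl fun i _ => ?_))
        simp
    _ ≤ _ := Finset.sum_mul_sq_le_sq_mul_sq _ _ _

theorem trace_mul_nonneg {d : ℕ} {A B : Op d} (hA : A.PosSemidef) (hB : B.PosSemidef) :
    0 ≤ (A * B).trace := by
  have hS : (CFC.sqrt A).PosSemidef := (CFC.sqrt_nonneg _).posSemidef
  have hSS : CFC.sqrt A * CFC.sqrt A = A := CFC.sqrt_mul_sqrt_self _ hA.nonneg
  rw [← hSS, Matrix.mul_assoc, trace_mul_comm]
  have := (hB.mul_mul_conjTranspose_same (CFC.sqrt A)).trace_nonneg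
  rwa [hS.isHermitian.eq] at this

/-- Nonnegativity in the order of `ℂ` includes being real, and a complex matrix with real quadratic
form is Hermitian. -/
theorem posSemidef_of_forall_nonneg {d : ℕ} {W : Op d}
    (h : ∀ v : Fin d → ℂ, 0 ≤ star v ⬝ᵥ W *ᵥ v) : W.PosSemidef := by
  rw [← isPositive_toEuclideanLin_iff, LinearMap.isPositive_iff_complex]
  intro x
  have e : inner ℂ (toEuclideanLin W x) x = star (star (x : Fin d → ℂ) ⬝ᵥ W *ᵥ x) := by
    rw [EuclideanSpace.inner_eq_star_dotProduct, ← star_dotProduct, dotProduct_comm]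
    rfl
  have hx := Complex.le_def.1 (h x)
  rw [e]
  refine ⟨Complex.ext (by simp) ?_, by simpa using hx.1⟩
  simpa using hx.2.symm

theorem trace_mul_proj {d : ℕ} (W : Op d) (ψ : EuclideanSpace ℂ (Fin d)) :
    (W * proj ψ).trace = star (ψ : Fin d → ℂ) ⬝ᵥ W *ᵥ ψ := by
  rw [proj_eq_vecMulVec, mul_vecMulVec, trace_vecMulVec, dotProduct_comm]

theorem hsInner_of_posSemidef {d : ℕ} {X : Op d} (hX : X.PosSemidef) (Y : Op d) :
    hsInner X Y = (Y * X).trace := by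
  rw [hsInner, hX.isHermitian.eq, trace_mul_comm]

/-- The adjoint of `Λ` applied to `Y`. -/
def dualMap {d : ℕ} (Λ : Op d →ₗ[ℂ] Op d) (Y : Op d) : Op d :=
  of fun i j => (Y * Λ (single j i 1)).trace

theorem trace_dualMap_mul {d : ℕ} (Λ : Op d →ₗ[ℂ] Op d) (Y X : Op d) :
    (dualMap Λ Y * X).trace = (Y * Λ X).trace := by
  conv_rhs => rw [matrix_eq_sum_single X]
  simp only [map_sum, Finset.mul_sum, trace_sum]
  have : ∀ i j, (Y * Λ (single i j (X i j))).trace = dualMap Λ Y j i * X i j := by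
    intro i j
    have : single i j (X i j) = X i j • single i j (1 : ℂ) := by simp
    rw [this, map_smul, mul_smul_comm, trace_smul, dualMap, of_apply, smul_eq_mul, mul_comm]
  simp only [this]
  rw [trace, Finset.sum_comm]
  simp only [diag_apply, mul_apply]

theorem IsChannel.dualMap_posSemidef {d : ℕ} {Λ : Op d →ₗ[ℂ] Op d} (h : IsChannel Λ) {Y : Op d}
    (hY : Y.PosSemidef) : (dualMap Λ Y).PosSemidef := by
  refine posSemidef_of_forall_nonneg fun v => ?_
  have := trace_mul_nonneg hY (h.map_posSemidef (proj_posSemidef (WithLp.toLp 2 v)))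
  rwa [← trace_dualMap_mul, trace_mul_proj] at this

theorem IsChannel.dualMap_one {d : ℕ} {Λ : Op d →ₗ[ℂ] Op d} (h : IsChannel Λ) :
    dualMap Λ 1 = 1 := by
  ext i j
  simp only [dualMap, of_apply, Matrix.one_mul, h.2]
  by_cases hij : i = j
  · subst hij; simp
  · rw [one_apply_ne hij, trace_single_eq_of_ne _ _ _ (Ne.symm hij)]

theorem dualMap_sub {d : ℕ} (Λ : Op d →ₗ[ℂ] Op d) (Y Z : Op d) :
    dualMap Λ (Y - Z) = dualMap Λ Y - dualMap Λ Z := by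
  ext i j
  simp [dualMap, Matrix.sub_mul]

theorem norm_maxCohVec {d m : ℕ} (hm : 1 ≤ m) (hmd : m ≤ d) : ‖maxCohVec d m‖ = 1 := by
  have hm0 : (0 : ℝ) < m := by exact_mod_cast hm
  have : ‖maxCohVec d m‖ ^ 2 = 1 := by
    rw [EuclideanSpace.norm_sq_eq]
    have e : ∀ i : Fin d, ‖maxCohVec d m i‖ ^ 2 = if (i : ℕ) < m then 1 / (m : ℝ) else 0 := by
      intro i
      simp only [maxCohVec]
      split_ifs
      · rw [Complex.norm_real, Real.norm_eq_abs, sq_abs, div_pow, Real.sq_sqrt hm0.le, one_pow]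
      · simp
    simp only [e]
    rw [← Finset.sum_filter, Finset.sum_const, Fin.card_filter_val_lt, min_eq_right hmd]
    simp
    field_simp
  nlinarith [norm_nonneg (maxCohVec d m)]

theorem one_sub_proj_posSemidef {d : ℕ} {ψ : EuclideanSpace ℂ (Fin d)} (h : ‖ψ‖ = 1) :
    (1 - proj ψ).PosSemidef := by
  have h1 : proj ψ * proj ψ = proj ψ := by
    have h2 : star (ψ : Fin d → ℂ) ⬝ᵥ ψ = 1 := by
      rw [← trace_proj]; exact (isState_proj h).2
    rw [proj_eq_vecMulVec, vecMulVec_mul_vecMulVec, h2]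
    simp
  have h3 : (1 - proj ψ)ᴴ * (1 - proj ψ) = 1 - proj ψ := by
    rw [conjTranspose_sub, (proj_posSemidef ψ).isHermitian.eq, conjTranspose_one]
    rw [Matrix.sub_mul, Matrix.mul_sub, Matrix.mul_sub, h1]
    simp
  rw [← h3]
  exact posSemidef_conjTranspose_mul_self _

theorem isIncoherent_single {d : ℕ} (j : Fin d) : IsIncoherent (single j j (1 : ℂ)) := by
  have e : single j j (1 : ℂ) = diagonal (Pi.single j 1) := by
    ext a b; simp [single_apply, diagonal_apply, Pi.single_apply]; grind
  refine ⟨⟨?_, trace_single_eq_same j 1⟩, ?_⟩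
  · rw [e, posSemidef_diagonal_iff]
    intro i
    by_cases h : i = j
    · subst h; simp
    · simp [h]
  · rw [e]
    ext a b
    by_cases h : a = b
    · subst h; simp [dephase]
    · simp [dephase, h]

/-- The entry is `Tr (Ψ_m Λ(|j⟩⟨j|))`. Since `Λ(|j⟩⟨j|)` is a diagonal state, only the diagonal of
`Ψ_m` contributes, and its entries are `1/m` or `0`. -/
theorem dualMap_maxCoh_diag_le {d m : ℕ} {O : FreeClass} {Λ : Op d →ₗ[ℂ] Op d}
    (h : O.Mem Λ) (j : Fin d) : (dualMap Λ (maxCoh d m) j j).re ≤ 1 / (m : ℝ) := by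
  have hI := h.isIncoherent (isIncoherent_single j)
  simp only [dualMap, of_apply]
  rw [hI.2, dephase]
  simp only [trace, diag_apply, mul_diagonal, Complex.re_sum]
  set τ := Λ (single j j 1)
  have e : ∀ i, (maxCoh d m i i * τ i i).re ≤ 1 / (m : ℝ) * (τ i i).re := by
    intro i
    have hτ := re_diag_nonneg hI.1.1 i
    have : maxCoh d m i i = if (i : ℕ) < m then ((1 / (m : ℝ) : ℝ) : ℂ) else 0 := by
      simp only [maxCoh, proj, of_apply, maxCohVec]
      split_ifs
      · simp only [RCLike.star_def, Complex.conj_ofReal]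
        rw [← Complex.ofReal_mul, div_mul_div_comm, one_mul, Real.mul_self_sqrt (by positivity)]
      · simp
    rw [this]
    split_ifs
    · rw [Complex.re_ofReal_mul]
    · simp only [zero_mul, Complex.zero_re]; positivity
  refine (Finset.sum_le_sum fun i _ => e i).trans ?_
  rw [← Finset.mul_sum, hI.1.sum_re_diag, mul_one]

/-- Cauchy-Schwarz for `√W e_j` and `√W v`. -/
theorem norm_sq_mulVec_apply_le {d : ℕ} {W : Op d} (hW : W.PosSemidef) (v : Fin d → ℂ)
    (j : Fin d) : ‖(W *ᵥ v) j‖ ^ 2 ≤ (W j j).re * (star v ⬝ᵥ W *ᵥ v).re := by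
  set S := CFC.sqrt W
  have hS : S.PosSemidef := (CFC.sqrt_nonneg _).posSemidef
  have hSS : S * S = W := CFC.sqrt_mul_sqrt_self _ hW.nonneg
  have hSj : ∀ i k, star (S i k) = S k i := fun i k => by
    conv_rhs => rw [← hS.isHermitian.eq, conjTranspose_apply]
  have e1 : (W *ᵥ v) j = star (fun k => S k j) ⬝ᵥ (S *ᵥ v) := by
    rw [← hSS, ← mulVec_mulVec]
    simp only [mulVec, dotProduct, Pi.star_apply, hSj]
  have e2 : ∑ k, ‖S k j‖ ^ 2 = (W j j).re := by
    rw [← hSS, mul_apply, Complex.re_sum]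
    refine Finset.sum_congr rfl fun k _ => ?_
    rw [← hSj k j, RCLike.star_def, Complex.conj_mul']
    norm_cast
  have e3 : ∑ k, ‖(S *ᵥ v) k‖ ^ 2 = (star v ⬝ᵥ W *ᵥ v).re := by
    rw [← Complex.ofReal_re (∑ k, ‖(S *ᵥ v) k‖ ^ 2), sum_sq_norm_eq_star_dotProduct, star_mulVec,
      hS.isHermitian.eq, ← dotProduct_mulVec, mulVec_mulVec, hSS]
  rw [e1, ← e2, ← e3]
  exact norm_sq_star_dotProduct_le _ _

/-- This is `W² ≤ W`, seen as `√W (1 - W) √W ≥ 0`. -/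
theorem sum_norm_sq_mulVec_le {d : ℕ} {W : Op d} (hW : W.PosSemidef) (hW1 : (1 - W).PosSemidef)
    (v : Fin d → ℂ) : ∑ j, ‖(W *ᵥ v) j‖ ^ 2 ≤ (star v ⬝ᵥ W *ᵥ v).re := by
  set S := CFC.sqrt W
  have hS : S.PosSemidef := (CFC.sqrt_nonneg _).posSemidef
  have hSS : S * S = W := CFC.sqrt_mul_sqrt_self _ hW.nonneg
  have e1 : ∑ j, ‖(W *ᵥ v) j‖ ^ 2 = (star v ⬝ᵥ (W * W) *ᵥ v).re := by
    rw [← Complex.ofReal_re (∑ k, ‖(W *ᵥ v) k‖ ^ 2), sum_sq_norm_eq_star_dotProduct, star_mulVec,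
      hW.isHermitian.eq, ← dotProduct_mulVec, mulVec_mulVec]
  have h := (hW1.mul_mul_conjTranspose_same S).re_dotProduct_nonneg v
  have e2 : S * (1 - W) * Sᴴ = W - W * W := by
    rw [hS.isHermitian.eq, Matrix.mul_sub, Matrix.sub_mul, Matrix.mul_one, ← hSS]
    simp only [Matrix.mul_assoc]
  rw [e2, sub_mulVec, dotProduct_sub, map_sub] at h
  rw [e1]
  simpa using h

theorem exists_complement_of_le {d : ℕ} {x : Fin d → ℝ} {c : ℝ} (hx : ∀ i, x i ≤ c)
    (hs : ∑ i, x i ≤ 1) (hc : 1 ≤ d * c) :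
    ∃ y : Fin d → ℝ, (∀ i, 0 ≤ y i) ∧ (∀ i, x i + y i ≤ c) ∧ ∑ i, (x i + y i) = 1 := by
  have hsum : ∑ i, (c - x i) = d * c - ∑ i, x i := by simp
  have h0 : 0 ≤ d * c - ∑ i, x i := by linarith
  have hθ0 : 0 ≤ (1 - ∑ i, x i) / (d * c - ∑ i, x i) := div_nonneg (by linarith) h0
  have hθ1 : (1 - ∑ i, x i) / (d * c - ∑ i, x i) ≤ 1 := div_le_one_of_le₀ (by linarith) h0
  -- Each slot gets the same fraction of its free room: missing mass over total room. If the room is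
  -- zero, so is the missing mass, and the value `0` of the quotient is right.
  refine ⟨fun i => (1 - ∑ i, x i) / (d * c - ∑ i, x i) * (c - x i), fun i => ?_, fun i => ?_, ?_⟩
  · exact mul_nonneg hθ0 (by linarith [hx i])
  · nlinarith [hx i]
  · rw [Finset.sum_add_distrib, ← Finset.mul_sum, hsum]
    rcases h0.eq_or_lt with h | h
    · rw [← h]; linarith
    · field_simp; ring

theorem mul_conjTranspose_self_apply_diag {d : ℕ} {ι : Type*} [Fintype ι]
    (B : Matrix (Fin d) ι ℂ) (j : Fin d) :
    ((B * Bᴴ) j j).re = ∑ i, ‖B j i‖ ^ 2 := by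
  rw [mul_apply, Complex.re_sum]
  refine Finset.sum_congr rfl fun i _ => ?_
  rw [conjTranspose_apply, RCLike.star_def, Complex.mul_conj']
  norm_cast

/-- A subnormalised `B Bᴴ` suffices: a diagonal block appended to `B`, facing a zero block in `A`,
fills it up to a state of `relaxedSet` without changing the trace. -/
theorem sq_re_trace_le_sdpFidelity {d m : ℕ} {ι : Type*} [Fintype ι] (hm : 1 ≤ m) (hmd : m ≤ d)
    {A B : Matrix (Fin d) ι ℂ} (h0 : 0 ≤ (Aᴴ * B).trace.re)
    (hdiag : ∀ j, ∑ i, ‖B j i‖ ^ 2 ≤ 1 / (m : ℝ)) (htr : ∑ j, ∑ i, ‖B j i‖ ^ 2 ≤ 1) :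
    (Aᴴ * B).trace.re ^ 2 ≤ sdpFidelity (A * Aᴴ) m := by
  have hm0 : (0 : ℝ) < m := by exact_mod_cast hm
  obtain ⟨y, hy0, hy, hys⟩ := exists_complement_of_le hdiag htr (by
    rw [mul_one_div, le_div_iff₀ hm0, one_mul]; exact_mod_cast hmd)
  let D : Op d := diagonal fun i => ((Real.sqrt (y i) : ℝ) : ℂ)
  have hD : D * Dᴴ = diagonal fun i => ((y i : ℝ) : ℂ) := by
    simp only [D, diagonal_conjTranspose, diagonal_mul_diagonal]
    congr 1
    ext i
    simp only [Pi.star_apply, RCLike.star_def, Complex.conj_ofReal]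
    rw [← Complex.ofReal_mul, Real.mul_self_sqrt (hy0 i)]
  have hBB : fromCols B D * (fromCols B D)ᴴ = B * Bᴴ + diagonal fun i => ((y i : ℝ) : ℂ) := by
    rw [conjTranspose_fromCols_eq_fromRows_conjTranspose, fromCols_mul_fromRows, hD]
  have hAA : fromCols A (0 : Op d) * (fromCols A (0 : Op d))ᴴ = A * Aᴴ := by
    rw [conjTranspose_fromCols_eq_fromRows_conjTranspose, fromCols_mul_fromRows]
    simp
  have hAB : ((fromCols A (0 : Op d))ᴴ * fromCols B D).trace = (Aᴴ * B).trace := by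
    rw [conjTranspose_fromCols_eq_fromRows_conjTranspose, fromRows_mul_fromCols]
    simp [trace, Fintype.sum_sum_type]
  have hpos := posSemidef_self_mul_conjTranspose (fromCols B D)
  have hre : ∀ j, ((fromCols B D * (fromCols B D)ᴴ) j j).re = ∑ i, ‖B j i‖ ^ 2 + y j := by
    intro j
    rw [hBB, Matrix.add_apply, Complex.add_re, mul_conjTranspose_self_apply_diag]
    simp
  have hmem : fromCols B D * (fromCols B D)ᴴ ∈ relaxedSet d m := by
    refine mem_relaxedSet_iff.2 ⟨⟨hpos, Complex.ext ?_ ?_⟩, fun j => ?_⟩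
    · rw [trace, Complex.re_sum, Complex.one_re, ← hys]
      exact Finset.sum_congr rfl fun j _ => hre j
    · exact (Complex.le_def.1 hpos.trace_nonneg).2.symm
    · rw [hre]; exact hy j
  have key := re_trace_le_traceNorm (fromCols A (0 : Op d)) (fromCols B D)
  rw [hAA, hAB] at key
  exact (pow_le_pow_left₀ h0 key 2).trans (fidelity_le_sdpFidelity (A * Aᴴ) hmem)

theorem sum_smul_proj_eq {d : ℕ} {ι : Type*} [Fintype ι] {p : ι → ℝ} (hp : ∀ i, 0 ≤ p i)
    (ψ : ι → EuclideanSpace ℂ (Fin d)) :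
    (of fun j i => (Real.sqrt (p i) : ℂ) * ψ i j : Matrix (Fin d) (ι) ℂ) *
      (of fun j i => (Real.sqrt (p i) : ℂ) * ψ i j : Matrix (Fin d) (ι) ℂ)ᴴ =
      ∑ i, (p i : ℂ) • proj (ψ i) := by
  ext j k
  rw [mul_apply, Matrix.sum_apply]
  refine Finset.sum_congr rfl fun i _ => ?_
  simp only [of_apply, conjTranspose_apply, Matrix.smul_apply, proj, smul_eq_mul, star_mul',
    RCLike.star_def, Complex.conj_ofReal]
  rw [mul_mul_mul_comm, ← Complex.ofReal_mul, Real.mul_self_sqrt (hp i)]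

theorem sdpFidelity_nonneg {d m : ℕ} (ρ : Op d) (hm : 1 ≤ m) (hmd : m ≤ d) :
    0 ≤ sdpFidelity ρ m :=
  (fidelity_nonneg ρ _).trans (fidelity_le_sdpFidelity ρ (maximallyMixed_mem_relaxedSet hm hmd))

theorem hsInner_map_proj {d m : ℕ} {Λ : Op d →ₗ[ℂ] Op d} (h : IsChannel Λ)
    (ψ : EuclideanSpace ℂ (Fin d)) :
    hsInner (Λ (proj ψ)) (maxCoh d m) =
      star (ψ : Fin d → ℂ) ⬝ᵥ dualMap Λ (maxCoh d m) *ᵥ ψ := by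
  rw [hsInner_of_posSemidef (h.map_posSemidef (proj_posSemidef ψ)), ← trace_dualMap_mul,
    trace_mul_proj]

theorem hsInner_sum_smul_re {d n : ℕ} (p : Fin n → ℝ) (X : Fin n → Op d) (Y : Op d) :
    (hsInner (∑ i, (p i : ℂ) • X i) Y).re = ∑ i, p i * (hsInner (X i) Y).re := by
  simp [hsInner, conjTranspose_sum, Matrix.sum_mul, trace_sum]

theorem le_sdpFidelity_of_decomposition {d m n : ℕ} (hm : 1 ≤ m) (hmd : m ≤ d) {O : FreeClass}
    {ρ : Op d} {p : Fin n → ℝ} {ψ : Fin n → EuclideanSpace ℂ (Fin d)}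
    {Λ : Fin n → (Op d →ₗ[ℂ] Op d)} (hdec : IsPureDecomposition ρ p ψ) (hΛ : ∀ i, O.Mem (Λ i)) :
    (hsInner (∑ i, (p i : ℂ) • Λ i (proj (ψ i))) (maxCoh d m)).re ≤ sdpFidelity ρ m := by
  obtain ⟨hp, -, -, hρ⟩ := hdec
  rw [hsInner_sum_smul_re]
  simp only [fun i => hsInner_map_proj (m := m) (hΛ i).isChannel]
  set W := fun i => dualMap (Λ i) (maxCoh d m) with hW
  set f := fun i => (star (ψ i : Fin d → ℂ) ⬝ᵥ W i *ᵥ ψ i).re with hf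
  change ∑ i, p i * f i ≤ _
  have hWp : ∀ i, (W i).PosSemidef := fun i =>
    (hΛ i).isChannel.dualMap_posSemidef (proj_posSemidef _)
  have hW1 : ∀ i, (1 - W i).PosSemidef := fun i => by
    have := (hΛ i).isChannel.dualMap_posSemidef
      (one_sub_proj_posSemidef (norm_maxCohVec hm hmd))
    rwa [dualMap_sub, (hΛ i).isChannel.dualMap_one] at this
  set T := ∑ i, p i * f i with hT
  rcases le_or_gt T 0 with hT0 | hT0
  · exact hT0.trans (sdpFidelity_nonneg ρ hm hmd)
  have hsT : 0 < Real.sqrt T := Real.sqrt_pos.2 hT0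
  let c : Fin n → ℝ := fun i => Real.sqrt (p i) / Real.sqrt T
  have hc : ∀ i, c i ^ 2 = p i / T := fun i => by
    rw [div_pow, Real.sq_sqrt (hp i), Real.sq_sqrt hT0.le]
  let A : Matrix (Fin d) (Fin n) ℂ := of fun j i => (Real.sqrt (p i) : ℂ) * ψ i j
  -- The factor `1/√T` in `c` normalises: both constraints on `B Bᴴ` reduce to `∑ (p i / T) * f i =
  -- 1`, while `Tr (Aᴴ B) = T/√T = √T`.
  let B : Matrix (Fin d) (Fin n) ℂ := of fun j i => (c i : ℂ) * (W i *ᵥ ψ i) j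
  have hB : ∀ j i, ‖B j i‖ ^ 2 = p i / T * ‖(W i *ᵥ ψ i) j‖ ^ 2 := fun j i => by
    simp only [B, of_apply]
    rw [norm_mul, mul_pow, Complex.norm_real, Real.norm_eq_abs, sq_abs, hc]
  have hAA : A * Aᴴ = ρ := by rw [hρ]; exact sum_smul_proj_eq hp ψ
  have hpT : ∀ i, 0 ≤ p i / T := fun i => div_nonneg (hp i) hT0.le
  have hAB : (Aᴴ * B).trace.re = Real.sqrt T := by
    have e : ∀ i, ((Aᴴ * B) i i).re = p i * f i / Real.sqrt T := by
      intro i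
      have : (Aᴴ * B) i i = ((p i / Real.sqrt T : ℝ) : ℂ) *
          (star (ψ i : Fin d → ℂ) ⬝ᵥ W i *ᵥ ψ i) := by
        rw [mul_apply, dotProduct, Finset.mul_sum]
        refine Finset.sum_congr rfl fun j _ => ?_
        have h1 : ((p i / Real.sqrt T : ℝ) : ℂ) = (Real.sqrt (p i) : ℂ) * (c i : ℂ) := by
          rw [← Complex.ofReal_mul, ← mul_div_assoc, Real.mul_self_sqrt (hp i)]
        rw [h1]
        simp only [A, B, conjTranspose_apply, of_apply, star_mul', RCLike.star_def,
          Complex.conj_ofReal, Pi.star_apply]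
        ring
      rw [this, Complex.re_ofReal_mul]
      simp only [hf]
      ring
    rw [trace, Complex.re_sum]
    simp only [diag_apply, e]
    rw [← Finset.sum_div, ← hT, Real.div_sqrt]
  have hfin : ∀ s : Fin n → ℝ, (∀ i, s i ≤ f i) → ∑ i, p i / T * s i ≤ 1 := by
    intro s hs
    calc ∑ i, p i / T * s i ≤ ∑ i, p i * f i / T := by
          refine Finset.sum_le_sum fun i _ => ?_
          rw [mul_div_right_comm]
          exact mul_le_mul_of_nonneg_left (hs i) (hpT i)
      _ = 1 := by rw [← Finset.sum_div, ← hT, div_self hT0.ne']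
  have := sq_re_trace_le_sdpFidelity (A := A) (B := B) hm hmd (by rw [hAB]; exact hsT.le)
    (fun j => by
      have hm0 : (0 : ℝ) < m := by exact_mod_cast hm
      simp only [hB]
      calc ∑ i, p i / T * ‖(W i *ᵥ ψ i) j‖ ^ 2 ≤ ∑ i, p i / T * (1 / (m : ℝ) * f i) := by
            refine Finset.sum_le_sum fun i _ => mul_le_mul_of_nonneg_left ?_ (hpT i)
            refine (norm_sq_mulVec_apply_le (hWp i) _ j).trans ?_
            exact mul_le_mul_of_nonneg_right (dualMap_maxCoh_diag_le (hΛ i) j)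
              ((hWp i).re_dotProduct_nonneg _)
        _ = 1 / (m : ℝ) * ∑ i, p i / T * f i := by
            rw [Finset.mul_sum]; exact Finset.sum_congr rfl fun i _ => by ring
        _ ≤ 1 / (m : ℝ) := mul_le_of_le_one_right (by positivity) (hfin f fun i => le_rfl))
    (by
      simp only [hB]
      rw [Finset.sum_comm]
      simp only [← Finset.mul_sum]
      exact hfin _ fun i => sum_norm_sq_mulVec_le (hWp i) (hW1 i) _)
  rwa [hAB, Real.sq_sqrt hT0.le, hAA] at this

theorem assistedFidelity_le_sdpFidelity {d m : ℕ} (O : FreeClass) (ρ : Op d) (hm : 1 ≤ m)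
    (hmd : m ≤ d) : assistedFidelity O ρ m ≤ sdpFidelity ρ m := by
  refine Real.sSup_le ?_ (sdpFidelity_nonneg ρ hm hmd)
  rintro x ⟨n, p, ψ, Λ, hdec, hΛ, rfl⟩
  exact le_sdpFidelity_of_decomposition hm hmd hdec hΛ

theorem le_assistedFidelity {d m n : ℕ} (hm : 1 ≤ m) (hmd : m ≤ d) {O : FreeClass}
    {ρ : Op d} {p : Fin n → ℝ} {ψ : Fin n → EuclideanSpace ℂ (Fin d)}
    {Λ : Fin n → (Op d →ₗ[ℂ] Op d)} (hdec : IsPureDecomposition ρ p ψ) (hΛ : ∀ i, O.Mem (Λ i)) :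
    (hsInner (∑ i, (p i : ℂ) • Λ i (proj (ψ i))) (maxCoh d m)).re ≤ assistedFidelity O ρ m := by
  refine le_csSup ⟨sdpFidelity ρ m, ?_⟩ ⟨n, p, ψ, Λ, hdec, hΛ, rfl⟩
  rintro x ⟨n, p, ψ, Λ, hdec, hΛ, rfl⟩
  exact le_sdpFidelity_of_decomposition hm hmd hdec hΛ

theorem assistedRate_le_sdpRate {d : ℕ} (O : FreeClass) (ρ : Op d) (ε : ℝ) :
    assistedRate O ε ρ ≤ sdpRate ε ρ := by
  unfold assistedRate sdpRate
  set S := {m : ℕ | 1 ≤ m ∧ m ≤ d ∧ 1 - ε ≤ assistedFidelity O ρ m}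
  set S' := {m : ℕ | 1 ≤ m ∧ m ≤ d ∧ 1 - ε ≤ sdpFidelity ρ m}
  have hsub : S ⊆ S' := fun m h =>
    ⟨h.1, h.2.1, h.2.2.trans (assistedFidelity_le_sdpFidelity O ρ h.1 h.2.1)⟩
  rcases S.eq_empty_or_nonempty with hS | hS
  -- Here `sSup ∅ = 0` and `logb 2 0 = 0`, so it remains that the other rate is nonnegative.
  · rw [hS, csSup_empty]
    simp only [bot_eq_zero, Nat.cast_zero, Real.logb_zero]
    rcases Nat.eq_zero_or_pos (sSup S') with h | h
    · simp [h]
    · exact Real.logb_nonneg (by norm_num) (by exact_mod_cast h)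
  · have hb : BddAbove S' := ⟨d, fun m h => h.2.1⟩
    have hle : sSup S ≤ sSup S' := csSup_le_csSup hb hS hsub
    obtain ⟨m, hmS⟩ := hS
    have h1 : 1 ≤ sSup S := hmS.1.trans (le_csSup (hb.mono hsub) hmS)
    exact Real.logb_le_logb_of_le (by norm_num) (by exact_mod_cast h1) (by exact_mod_cast hle)

/-! ### Monomial Kraus operators and free transformations of pure states. -/

/-- The matrix `∑ j, c j |σ j⟩⟨j|`. -/
def monomial {d : ℕ} (σ : Equiv.Perm (Fin d)) (c : Fin d → ℂ) : Op d :=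
  of fun i j => if i = σ j then c j else 0

/-- The map `X ↦ ∑ l, K_l X K_l†`. -/
def krausMap {d : ℕ} {ι : Type*} [Fintype ι] (K : ι → Op d) : Op d →ₗ[ℂ] Op d where
  toFun X := ∑ l, K l * X * (K l)ᴴ
  map_add' X Y := by simp [Matrix.mul_add, Matrix.add_mul, Finset.sum_add_distrib]
  map_smul' c X := by simp [Finset.smul_sum]

theorem krausMap_apply {d : ℕ} {ι : Type*} [Fintype ι] (K : ι → Op d) (X : Op d) :
    krausMap K X = ∑ l, K l * X * (K l)ᴴ := rfl

theorem monomial_mul_apply {d : ℕ} (σ : Equiv.Perm (Fin d)) (c : Fin d → ℂ) (X : Op d)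
    (a b : Fin d) : (monomial σ c * X) a b = c (σ.symm a) * X (σ.symm a) b := by
  rw [mul_apply, Finset.sum_eq_single (σ.symm a)]
  · simp [monomial]
  · intro j _ hj
    have : a ≠ σ j := fun h => hj (by simp [h])
    simp [monomial, this]
  · simp

theorem mul_conjTranspose_monomial_apply {d : ℕ} (σ : Equiv.Perm (Fin d)) (c : Fin d → ℂ)
    (X : Op d) (a b : Fin d) :
    (X * (monomial σ c)ᴴ) a b = X a (σ.symm b) * star (c (σ.symm b)) := by
  have : X * (monomial σ c)ᴴ = (monomial σ c * Xᴴ)ᴴ := by simp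
  rw [this, conjTranspose_apply, monomial_mul_apply]
  simp [mul_comm]

theorem conjTranspose_monomial {d : ℕ} (σ : Equiv.Perm (Fin d)) (c : Fin d → ℂ) :
    (monomial σ c)ᴴ = monomial σ.symm fun j => star (c (σ.symm j)) := by
  ext i j
  have : j = σ i ↔ i = σ.symm j := by rw [Equiv.eq_symm_apply, eq_comm]
  by_cases h : i = σ.symm j
  · simp [monomial, h]
  · simp [monomial, h, this]

theorem dephase_monomial_conj {d : ℕ} (σ : Equiv.Perm (Fin d)) (c : Fin d → ℂ) (X : Op d) :
    dephase (monomial σ c * X * (monomial σ c)ᴴ) =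
      monomial σ c * dephase X * (monomial σ c)ᴴ := by
  ext a b
  simp only [mul_conjTranspose_monomial_apply, monomial_mul_apply, dephase, diagonal_apply]
  by_cases h : a = b
  · simp [h]
  · simp [h]

theorem conjTranspose_monomial_mul_self {d : ℕ} (σ : Equiv.Perm (Fin d)) (c : Fin d → ℂ) :
    (monomial σ c)ᴴ * monomial σ c = diagonal fun j => ((‖c j‖ ^ 2 : ℝ) : ℂ) := by
  rw [conjTranspose_monomial]
  ext i j
  rw [monomial_mul_apply, diagonal_apply]
  by_cases h : i = j
  · simp [monomial, h, Complex.conj_mul']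
  · simp [monomial, h]

theorem isIncoherentOp_monomial {d : ℕ} (σ : Equiv.Perm (Fin d)) (c : Fin d → ℂ) :
    IsIncoherentOp (monomial σ c) := by
  intro ρ hρ h
  have hpos := hρ.1.1.mul_mul_conjTranspose_same (monomial σ c)
  refine ⟨⟨hpos.smul ?_, ?_⟩, ?_⟩
  · exact inv_nonneg.2 hpos.trace_nonneg
  · rw [trace_smul, smul_eq_mul, inv_mul_cancel₀ h]
  · rw [dephase_smul, dephase_monomial_conj, ← hρ.2]

theorem isChannel_krausMap {d : ℕ} {ι : Type*} [Fintype ι] {K : ι → Op d}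
    (h : ∑ l, (K l)ᴴ * K l = 1) : IsChannel (krausMap K) := by
  refine ⟨fun n X hX => ?_, fun X => ?_⟩
  · have e : amplify n (krausMap K) X =
        ∑ l, kroneckerMap (· * ·) (1 : Matrix (Fin n) (Fin n) ℂ) (K l) * X *
          (kroneckerMap (· * ·) (1 : Matrix (Fin n) (Fin n) ℂ) (K l))ᴴ := by
      ext ⟨a, i⟩ ⟨b, j⟩
      simp only [amplify, krausMap_apply, of_apply, Matrix.sum_apply]
      refine Finset.sum_congr rfl fun l _ => ?_
      simp only [mul_apply, Fintype.sum_prod_type, one_apply, kroneckerMap_apply,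
        conjTranspose_apply, ite_mul, one_mul, zero_mul, Finset.sum_ite_irrel,
        Finset.sum_const_zero, Finset.sum_ite_eq, Finset.mem_univ, if_true]
      rw [Finset.sum_eq_single b (fun x _ hx => by simp [hx.symm]) (by simp)]
      simp
    rw [e]
    exact posSemidef_sum _ fun l _ => hX.mul_mul_conjTranspose_same _
  · rw [krausMap_apply, trace_sum]
    simp only [fun l => trace_mul_comm (K l * X) (K l)ᴴ, ← Matrix.mul_assoc]
    rw [← trace_sum, ← Finset.sum_mul, h, Matrix.one_mul]

theorem isKraus_krausMap {d : ℕ} {ι : Type*} [Fintype ι] (K : ι → Op d) :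
    IsKraus (krausMap K) fun l => K ((Fintype.equivFin ι).symm l) := fun X => by
  rw [krausMap_apply]
  exact (Equiv.sum_comp (Fintype.equivFin ι).symm fun l => K l * X * (K l)ᴴ).symm

/-- Monomial matrices and their adjoints are incoherent, and conjugation by them commutes with
dephasing, so one construction serves all four classes. -/
theorem mem_krausMap_monomial {d : ℕ} (O : FreeClass) {ι : Type*} [Fintype ι]
    (σ : ι → Equiv.Perm (Fin d)) (c : ι → Fin d → ℂ) (h : ∀ j, ∑ l, ‖c l j‖ ^ 2 = 1) :
    O.Mem (krausMap fun l => monomial (σ l) (c l)) := by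
  have hc : IsChannel (krausMap fun l => monomial (σ l) (c l)) := by
    refine isChannel_krausMap ?_
    simp only [conjTranspose_monomial_mul_self]
    ext i j
    rw [Matrix.sum_apply]
    by_cases hij : i = j
    · subst hij
      simp only [diagonal_apply_eq, one_apply_eq]
      exact_mod_cast h i
    · simp [hij]
  have hdeph : ∀ X, dephase (krausMap (fun l => monomial (σ l) (c l)) X) =
      krausMap (fun l => monomial (σ l) (c l)) (dephase X) := by
    intro X
    simp only [krausMap_apply, dephase_sum, dephase_monomial_conj]
  cases O
  · exact ⟨hc, fun ρ hρ => ⟨hc.map_isState hρ.1, by rw [hdeph, ← hρ.2]⟩⟩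
  · exact ⟨hc, hdeph⟩
  · exact ⟨hc, _, _, isKraus_krausMap _, fun l => isIncoherentOp_monomial _ _⟩
  · exact ⟨hc, _, _, isKraus_krausMap _, fun l => ⟨isIncoherentOp_monomial _ _, by
      rw [conjTranspose_monomial]; exact isIncoherentOp_monomial _ _⟩⟩

/-- A probability vector with entries at most `1 / m` is a mixture of permutations of the uniform
distribution on `m` points. -/
theorem exists_perm_mixture {d m : ℕ} (hm : 1 ≤ m) (hmd : m ≤ d) {t : Fin d → ℝ}
    (h0 : ∀ j, 0 ≤ t j) (h1 : ∀ j, t j ≤ 1 / (m : ℝ)) (hs : ∑ j, t j = 1) :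
    ∃ w : Equiv.Perm (Fin d) → ℝ, (∀ σ, 0 ≤ w σ) ∧ ∑ σ, w σ = 1 ∧
      ∀ j, ∑ σ, w σ * (if (σ j : ℕ) < m then 1 / (m : ℝ) else 0) = t j := by
  have hm0 : (0 : ℝ) < m := by exact_mod_cast hm
  have hmd' : (m : ℝ) ≤ d := by exact_mod_cast hmd
  have ht : ∀ j, m * t j ≤ 1 := fun j => by
    have := h1 j
    rw [le_div_iff₀ hm0] at this
    linarith
  -- This matrix sends the uniform distribution on the first `m` points to `t`; the last `d - m`
  -- columns share what is left of each row. Birkhoff's theorem splits it into permutations. When `m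
  -- = d`, every `1 - m * t j` vanishes.
  let M : Matrix (Fin d) (Fin d) ℝ :=
    of fun j k => if (k : ℕ) < m then t j else (1 - m * t j) / (d - m)
  have hM0 : ∀ j k, 0 ≤ M j k := fun j k => by
    simp only [M, of_apply]
    split_ifs
    · exact h0 j
    · exact div_nonneg (by linarith [ht j]) (by linarith)
  have hcount : ((Finset.univ.filter fun k : Fin d => (k : ℕ) < m).card : ℝ) = m := by
    rw [Fin.card_filter_val_lt, min_eq_right hmd]
  have hcount' : ((Finset.univ.filter fun k : Fin d => ¬ (k : ℕ) < m).card : ℝ) = d - m := by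
    have := Finset.card_filter_add_card_filter_not (s := (Finset.univ : Finset (Fin d)))
      (fun k : Fin d => (k : ℕ) < m)
    rw [Finset.card_univ, Fintype.card_fin] at this
    rw [← hcount, eq_sub_iff_add_eq, add_comm]
    exact_mod_cast this
  have hsum : ∀ a b : ℝ, ∑ k : Fin d, (if (k : ℕ) < m then a else b) = m * a + (d - m) * b := by
    intro a b
    rw [Finset.sum_ite, Finset.sum_const, Finset.sum_const, nsmul_eq_mul, nsmul_eq_mul, hcount,
      hcount']
  have hsum1 : ∑ j, (1 - m * t j) = d - m := by
    rw [Finset.sum_sub_distrib, ← Finset.mul_sum, hs]; simp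
  have hM : M ∈ doublyStochastic ℝ (Fin d) := by
    refine mem_doublyStochastic_iff_sum.2 ⟨hM0, fun j => ?_, fun k => ?_⟩
    · simp only [M, of_apply, hsum]
      rcases hmd'.eq_or_lt with h | h
      · have hz : ∀ j ∈ Finset.univ, (1 - m * t j) = 0 :=
          (Finset.sum_eq_zero_iff_of_nonneg fun j _ => by linarith [ht j]).1
            (by rw [hsum1, h, sub_self])
        have := hz j (Finset.mem_univ j)
        rw [h, sub_self, zero_mul, ← h]
        linarith
      · rw [mul_div_cancel₀ _ (by linarith : (d : ℝ) - m ≠ 0)]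
        ring
    · simp only [M, of_apply]
      split_ifs with hk
      · exact hs
      · have hlt : (m : ℝ) < d := by
          have := k.2
          exact_mod_cast (by omega : m < d)
        rw [← Finset.sum_div, hsum1, div_self (by linarith)]
  obtain ⟨w, hw0, hw1, hw⟩ := exists_eq_sum_perm_of_mem_doublyStochastic hM
  refine ⟨w, hw0, hw1, fun j => ?_⟩
  have e : ∑ k, M j k * (if (k : ℕ) < m then 1 / (m : ℝ) else 0) = t j := by
    have : ∀ k : Fin d, M j k * (if (k : ℕ) < m then 1 / (m : ℝ) else 0) =
        if (k : ℕ) < m then t j * (1 / m) else 0 := fun k => by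
      simp only [M, of_apply]
      split_ifs <;> simp
    simp only [this, hsum]
    field_simp
    ring
  rw [← e, ← hw]
  simp only [Matrix.sum_apply, Finset.sum_mul]
  rw [Finset.sum_comm]
  refine Finset.sum_congr rfl fun σ _ => ?_
  rw [Finset.sum_eq_single (σ j)]
  · simp [Equiv.Perm.permMatrix, PEquiv.toMatrix_apply]
  · intro k _ hk
    simp [Equiv.Perm.permMatrix, PEquiv.toMatrix_apply, hk.symm]
  · simp

theorem trace_proj_mul_conj {d : ℕ} (φ ψ : EuclideanSpace ℂ (Fin d)) (K : Op d) :
    (proj φ * (K * proj ψ * Kᴴ)).trace.re = ‖star (φ : Fin d → ℂ) ⬝ᵥ K *ᵥ ψ‖ ^ 2 := by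
  have e : K * proj ψ * Kᴴ = proj (WithLp.toLp 2 (K *ᵥ ψ)) := by
    rw [proj_eq_vecMulVec, proj_eq_vecMulVec, mul_vecMulVec, vecMulVec_mul, ← star_mulVec]
  rw [e, trace_mul_proj, proj_eq_vecMulVec, vecMulVec_mulVec]
  set x : Fin d → ℂ := K *ᵥ ψ
  have : star (WithLp.toLp 2 x).ofLp ⬝ᵥ MulOpposite.op (star φ.ofLp ⬝ᵥ x) • φ.ofLp =
      (star φ.ofLp ⬝ᵥ x) * star (star φ.ofLp ⬝ᵥ x) := by
    rw [← star_dotProduct]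
    simp [dotProduct_smul]
  rw [this, RCLike.star_def, Complex.mul_conj']
  norm_cast

theorem hsInner_krausMap_proj {d m : ℕ} {ι : Type*} [Fintype ι] (K : ι → Op d)
    (ψ : EuclideanSpace ℂ (Fin d)) :
    (hsInner (krausMap K (proj ψ)) (maxCoh d m)).re =
      ∑ l, ‖star (maxCohVec d m : Fin d → ℂ) ⬝ᵥ K l *ᵥ ψ‖ ^ 2 := by
  have hpos : (krausMap K (proj ψ)).PosSemidef :=
    posSemidef_sum _ fun l _ => (proj_posSemidef ψ).mul_mul_conjTranspose_same _
  rw [hsInner_of_posSemidef hpos, krausMap_apply, Finset.mul_sum, trace_sum, Complex.re_sum]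
  exact Finset.sum_congr rfl fun l _ => trace_proj_mul_conj _ _ _

theorem star_dotProduct_monomial_mulVec {d : ℕ} (σ : Equiv.Perm (Fin d)) (c φ ψ : Fin d → ℂ) :
    star φ ⬝ᵥ monomial σ c *ᵥ ψ = ∑ j, star (φ (σ j)) * c j * ψ j := by
  simp only [dotProduct, mulVec, Finset.mul_sum]
  rw [Finset.sum_comm]
  refine Finset.sum_congr rfl fun j _ => ?_
  rw [Finset.sum_eq_single (σ j)]
  · simp [monomial, mul_assoc]
  · intro k _ hk
    simp [monomial, hk]
  · simp

/-- A pure state `η` with populations at most `1 / m` can be mapped to `Ψ_m` in every free class;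
the image of `ψ` then overlaps with `Ψ_m` at least as much as `ψ` does with `η`. -/
theorem exists_mem_norm_sq_le {d m : ℕ} (O : FreeClass) (hm : 1 ≤ m) (hmd : m ≤ d)
    {η : EuclideanSpace ℂ (Fin d)} (hη : ‖η‖ = 1) (hdiag : ∀ j, ‖η j‖ ^ 2 ≤ 1 / (m : ℝ)) :
    ∃ Λ : Op d →ₗ[ℂ] Op d, O.Mem Λ ∧ ∀ ψ : EuclideanSpace ℂ (Fin d),
      ‖star (η : Fin d → ℂ) ⬝ᵥ ψ‖ ^ 2 ≤ (hsInner (Λ (proj ψ)) (maxCoh d m)).re := by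
  obtain ⟨w, hw0, hw1, hw⟩ := exists_perm_mixture hm hmd (fun j => by positivity) hdiag
    (by rw [← EuclideanSpace.norm_sq_eq, hη, one_pow])
  let u : Fin d → ℝ := fun k => if (k : ℕ) < m then 1 / Real.sqrt m else 0
  have hu : ∀ k, u k * u k = if (k : ℕ) < m then 1 / (m : ℝ) else 0 := fun k => by
    simp only [u]
    split_ifs
    · rw [div_mul_div_comm, one_mul, Real.mul_self_sqrt (by positivity)]
    · simp
  have hmu : ∀ k, maxCohVec d m k = (u k : ℂ) := fun k => by
    simp only [maxCohVec, u]
    split_ifs <;> simp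
  simp only [← hu] at hw
  -- The operator for `some σ` is chosen to send `η` to `√(w σ) Ψ_m`. The extra operator for `none`
  -- restores trace preservation on the basis vectors where `η` vanishes, where the division by `η j
  -- = 0` gives `0`.
  let c : Option (Equiv.Perm (Fin d)) → Fin d → ℂ := fun o j =>
    o.elim (if η j = 0 then 1 else 0) fun σ => (Real.sqrt (w σ) : ℂ) * (u (σ j) : ℂ) / η j
  let τ : Option (Equiv.Perm (Fin d)) → Equiv.Perm (Fin d) := fun o => o.elim 1 id
  refine ⟨krausMap fun o => monomial (τ o) (c o), mem_krausMap_monomial O τ c fun j => ?_,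
    fun ψ => ?_⟩
  · rw [Fintype.sum_option]
    by_cases hj : η j = 0
    · simp [c, hj]
    · have hj' : ‖η j‖ ^ 2 ≠ 0 := by simpa using hj
      have : ∀ σ, ‖c (some σ) j‖ ^ 2 = w σ * (u (σ j) * u (σ j)) / ‖η j‖ ^ 2 := fun σ => by
        simp only [c, Option.elim_some]
        rw [norm_div, norm_mul, Complex.norm_real, Complex.norm_real, div_pow, mul_pow,
          Real.norm_eq_abs, Real.norm_eq_abs, sq_abs, sq_abs, Real.sq_sqrt (hw0 σ), sq]
      simp only [this]
      rw [← Finset.sum_div, hw, div_self hj']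
      simp [c, hj]
  · rw [hsInner_krausMap_proj, Fintype.sum_option]
    refine le_add_of_nonneg_of_le (by positivity) ?_
    set z : Equiv.Perm (Fin d) → ℂ := fun σ =>
      star (maxCohVec d m : Fin d → ℂ) ⬝ᵥ monomial (τ (some σ)) (c (some σ)) *ᵥ ψ with hz
    -- Equivalently `∑ √(w σ) K_σᴴ Ψ_m = η`. Since `√w` is a unit vector, Cauchy-Schwarz bounds the
    -- overlap by `∑ |z σ|²`.
    have e : star (η : Fin d → ℂ) ⬝ᵥ ψ = star (fun σ => (Real.sqrt (w σ) : ℂ)) ⬝ᵥ z := by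
      have h1 : ∀ σ, z σ = ∑ j, (Real.sqrt (w σ) : ℂ) * ((u (σ j) * u (σ j) : ℝ) : ℂ) / η j * ψ j := by
        intro σ
        simp only [hz]
        rw [star_dotProduct_monomial_mulVec]
        refine Finset.sum_congr rfl fun j _ => ?_
        simp only [τ, c, Option.elim_some, id, hmu, RCLike.star_def, Complex.conj_ofReal]
        push_cast
        ring
      have h2 : star (fun σ => (Real.sqrt (w σ) : ℂ)) ⬝ᵥ z =
          ∑ j, ((∑ σ, w σ * (u (σ j) * u (σ j)) : ℝ) : ℂ) / η j * ψ j := by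
        simp only [dotProduct, h1, Finset.mul_sum, Pi.star_apply, RCLike.star_def,
          Complex.conj_ofReal]
        rw [Finset.sum_comm]
        refine Finset.sum_congr rfl fun j _ => ?_
        push_cast
        rw [Finset.sum_div, Finset.sum_mul]
        refine Finset.sum_congr rfl fun σ _ => ?_
        have : (w σ : ℂ) = (Real.sqrt (w σ) : ℂ) * (Real.sqrt (w σ) : ℂ) := by
          rw [← Complex.ofReal_mul, Real.mul_self_sqrt (hw0 σ)]
        rw [this]
        ring
      rw [h2, dotProduct]
      refine Finset.sum_congr rfl fun j _ => ?_
      rw [hw j, Pi.star_apply, RCLike.star_def]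
      by_cases hj : η j = 0
      · simp [hj]
      · push_cast
        rw [← Complex.conj_mul']
        field_simp
    rw [e]
    refine (norm_sq_star_dotProduct_le _ _).trans ?_
    have : ∑ σ, ‖(Real.sqrt (w σ) : ℂ)‖ ^ 2 = 1 := by
      rw [← hw1]
      refine Finset.sum_congr rfl fun σ _ => ?_
      rw [Complex.norm_real, Real.norm_eq_abs, sq_abs, Real.sq_sqrt (hw0 σ)]
    rw [this, one_mul]

/-! ### Extreme points of the relaxed set in dimension at most three. -/

theorem re_smul_apply {d : ℕ} (a : ℝ) (X : Op d) (i j : Fin d) :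
    ((a • X) i j).re = a * (X i j).re := by
  simp

theorem convex_relaxedSet (d m : ℕ) : Convex ℝ (relaxedSet d m) := by
  intro X hX Y hY a b ha hb hab
  rw [mem_relaxedSet_iff] at *
  refine ⟨⟨(hX.1.1.smul ha).add (hY.1.1.smul hb), ?_⟩, fun i => ?_⟩
  · rw [trace_add, trace_smul, trace_smul, hX.1.2, hY.1.2, ← add_smul, hab, one_smul]
  · rw [Matrix.add_apply, Complex.add_re, re_smul_apply, re_smul_apply]
    calc a * (X i i).re + b * (Y i i).re ≤ a * (1 / m) + b * (1 / m) := by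
          gcongr
          · exact hX.2 i
          · exact hY.2 i
      _ = 1 / m := by rw [← add_mul, hab, one_mul]

theorem closure_convexHull_extremePoints_relaxedSet (d m : ℕ) :
    closure (convexHull ℝ ((relaxedSet d m).extremePoints ℝ)) = relaxedSet d m := by
  open scoped Matrix.Norms.L2Operator in
  exact closure_convexHull_extremePoints (isCompact_relaxedSet d m) (convex_relaxedSet d m)

theorem star_dotProduct_vecMulVec_mulVec {ι : Type*} [Fintype ι] (x y v : ι → ℂ) :
    star v ⬝ᵥ vecMulVec x (star y) *ᵥ v = (star y ⬝ᵥ v) * star (star x ⬝ᵥ v) := by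
  rw [vecMulVec_mulVec, ← star_dotProduct]
  simp [dotProduct_smul]

/-- The Hermitian matrix `a |x⟩⟨x| + b |y⟩⟨y| + c |x⟩⟨y| + c̄ |y⟩⟨x|`. -/
def pairHermitian {d : ℕ} (x y : Fin d → ℂ) (a b : ℝ) (c : ℂ) : Op d :=
  (a : ℂ) • vecMulVec x (star x) + (b : ℂ) • vecMulVec y (star y) +
    (c • vecMulVec x (star y) + star c • vecMulVec y (star x))

theorem pairHermitian_form {d : ℕ} (x y v : Fin d → ℂ) (a b : ℝ) (c : ℂ) :
    star v ⬝ᵥ pairHermitian x y a b c *ᵥ v =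
      ((a * ‖star x ⬝ᵥ v‖ ^ 2 + b * ‖star y ⬝ᵥ v‖ ^ 2 +
        2 * (c * ((star y ⬝ᵥ v) * star (star x ⬝ᵥ v))).re : ℝ) : ℂ) := by
  simp only [pairHermitian, add_mulVec, smul_mulVec, dotProduct_add, dotProduct_smul,
    star_dotProduct_vecMulVec_mulVec, smul_eq_mul]
  set X := star x ⬝ᵥ v
  set Y := star y ⬝ᵥ v
  have h : c * (Y * star X) + star c * (X * star Y) = ((2 * (c * (Y * star X)).re : ℝ) : ℂ) := by
    rw [← Complex.add_conj]
    simp [mul_comm]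
  rw [h]
  simp only [RCLike.star_def, Complex.mul_conj']
  push_cast
  rfl

theorem pairHermitian_apply_diag {d : ℕ} (x y : Fin d → ℂ) (a b : ℝ) (c : ℂ) (j : Fin d) :
    pairHermitian x y a b c j j =
      ((a * ‖x j‖ ^ 2 + b * ‖y j‖ ^ 2 + 2 * (c * (x j * star (y j))).re : ℝ) : ℂ) := by
  have h : c * (x j * star (y j)) + star c * (y j * star (x j)) =
      ((2 * (c * (x j * star (y j))).re : ℝ) : ℂ) := by
    rw [← Complex.add_conj]
    simp [mul_comm]
  simp only [pairHermitian, Matrix.add_apply, Matrix.smul_apply, vecMulVec_apply, smul_eq_mul,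
    Pi.star_apply]
  rw [h]
  simp only [RCLike.star_def, Complex.mul_conj']
  push_cast
  rfl

/-- Dimension count: `(a, b, c)` ranges over a real space of dimension four and the diagonal imposes
`d ≤ 3` real linear conditions. The restriction on the dimension enters here. -/
theorem exists_pairHermitian_diag_eq_zero {d : ℕ} (hd : d ≤ 3) (x y : Fin d → ℂ) :
    ∃ (a b : ℝ) (c : ℂ), (a, b, c) ≠ 0 ∧ ∀ j, pairHermitian x y a b c j j = 0 := by
  let L : ℝ × ℝ × ℂ →ₗ[ℝ] (Fin d → ℝ) :=
    { toFun := fun p j => p.1 * ‖x j‖ ^ 2 + p.2.1 * ‖y j‖ ^ 2 +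
        2 * (p.2.2 * (x j * star (y j))).re
      map_add' := fun p q => by
        ext j
        simp only [Prod.fst_add, Prod.snd_add, add_mul, Complex.add_re, Pi.add_apply]
        ring
      map_smul' := fun r p => by
        ext j
        simp only [Prod.smul_fst, Prod.smul_snd, smul_eq_mul, Complex.real_smul, mul_assoc,
          Complex.re_ofReal_mul, Pi.smul_apply, RingHom.id_apply]
        ring }
  have hL : LinearMap.ker L ≠ ⊥ := LinearMap.ker_ne_bot_of_finrank_lt (by
    simp only [Module.finrank_prod, Module.finrank_self, Complex.finrank_real_complex,
      Module.finrank_fintype_fun_eq_card, Fintype.card_fin]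
    omega)
  obtain ⟨⟨a, b, c⟩, hp, hp0⟩ := (Submodule.ne_bot_iff _).1 hL
  refine ⟨a, b, c, hp0, fun j => ?_⟩
  rw [pairHermitian_apply_diag]
  exact_mod_cast congrFun (LinearMap.mem_ker.1 hp) j

theorem pairHermitian_ne_zero {d : ℕ} {x y : Fin d → ℂ}
    (hxy : ∀ α β : ℂ, α • x + β • y = 0 → α = 0 ∧ β = 0) {a b : ℝ} {c : ℂ}
    (h : (a, b, c) ≠ 0) : pairHermitian x y a b c ≠ 0 := by
  intro h0
  have hv : ∀ v : Fin d → ℂ, ((a : ℂ) * (star x ⬝ᵥ v) + c * (star y ⬝ᵥ v)) = 0 ∧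
      ((b : ℂ) * (star y ⬝ᵥ v) + star c * (star x ⬝ᵥ v)) = 0 := by
    intro v
    refine hxy _ _ ?_
    have := congrArg (fun M : Op d => M *ᵥ v) h0
    simp only [pairHermitian, add_mulVec, smul_mulVec, vecMulVec_mulVec, zero_mulVec] at this
    rw [← this]
    ext j
    simp
    ring
  have h1 : (a : ℂ) • x + star c • y = 0 := by
    ext j
    have := congrArg star (hv (Pi.single j 1)).1
    simpa using this
  have h2 : (b : ℂ) • y + c • x = 0 := by
    ext j
    have := congrArg star (hv (Pi.single j 1)).2
    simpa using this
  have h3 := hxy _ _ h1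
  have h4 := hxy _ _ ((add_comm _ _).trans h2)
  apply h
  have ha : a = 0 := by exact_mod_cast h3.1
  have hb : b = 0 := by exact_mod_cast h4.2
  simp [ha, hb, h4.1]

/-- The perturbation's quadratic form is at most `(|a| + |b| + ‖c‖)(‖X‖² + ‖Y‖²)` in absolute value,
and columns `k`, `l` alone contribute `‖X‖² + ‖Y‖²` to that of `B Bᴴ`. -/
theorem posSemidef_add_pairHermitian {d : ℕ} {ι : Type*} [Fintype ι] [DecidableEq ι]
    (B : Matrix (Fin d) ι ℂ) {k l : ι} (hkl : k ≠ l) {a b : ℝ} {c : ℂ} {s : ℝ}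
    (hs : |s| * (|a| + |b| + ‖c‖) ≤ 1) :
    (B * Bᴴ + (s : ℂ) • pairHermitian (fun i => B i k) (fun i => B i l) a b c).PosSemidef := by
  refine posSemidef_of_forall_nonneg fun v => ?_
  have h1 : star v ⬝ᵥ (B * Bᴴ) *ᵥ v = ((∑ i, ‖star (fun j => B j i) ⬝ᵥ v‖ ^ 2 : ℝ) : ℂ) := by
    have h2 : star v ⬝ᵥ (B * Bᴴ) *ᵥ v = star (Bᴴ *ᵥ v) ⬝ᵥ (Bᴴ *ᵥ v) := by
      rw [star_mulVec, conjTranspose_conjTranspose, ← dotProduct_mulVec, mulVec_mulVec]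
    rw [h2, ← sum_sq_norm_eq_star_dotProduct]
    rfl
  rw [add_mulVec, smul_mulVec, dotProduct_add, dotProduct_smul, h1, pairHermitian_form, smul_eq_mul,
    ← Complex.ofReal_mul, ← Complex.ofReal_add, ← Complex.ofReal_zero, Complex.real_le_real]
  set X := star (fun i => B i k) ⬝ᵥ v
  set Y := star (fun i => B i l) ⬝ᵥ v
  have h3 : ‖X‖ ^ 2 + ‖Y‖ ^ 2 ≤ ∑ i, ‖star (fun j => B j i) ⬝ᵥ v‖ ^ 2 := by
    rw [← Finset.sum_pair (f := fun i => ‖star (fun j => B j i) ⬝ᵥ v‖ ^ 2) hkl]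
    exact Finset.sum_le_sum_of_subset_of_nonneg (Finset.subset_univ _) fun _ _ _ => by positivity
  have h4 : |(c * (Y * star X)).re| ≤ ‖c‖ * (‖Y‖ * ‖X‖) := by
    refine (Complex.abs_re_le_norm _).trans (le_of_eq ?_)
    simp
  have h5 : |a * ‖X‖ ^ 2 + b * ‖Y‖ ^ 2 + 2 * (c * (Y * star X)).re| ≤
      (|a| + |b| + ‖c‖) * (‖X‖ ^ 2 + ‖Y‖ ^ 2) := by
    have e1 : |a * ‖X‖ ^ 2| = |a| * ‖X‖ ^ 2 := by rw [abs_mul, abs_of_nonneg (sq_nonneg ‖X‖)]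
    have e2 : |b * ‖Y‖ ^ 2| = |b| * ‖Y‖ ^ 2 := by rw [abs_mul, abs_of_nonneg (sq_nonneg ‖Y‖)]
    have e3 : |2 * (c * (Y * star X)).re| = 2 * |(c * (Y * star X)).re| := by
      rw [abs_mul, abs_two]
    have e4 : 2 * (‖c‖ * (‖Y‖ * ‖X‖)) ≤ ‖c‖ * (‖X‖ ^ 2 + ‖Y‖ ^ 2) := by
      nlinarith [mul_nonneg (norm_nonneg c) (sq_nonneg (‖X‖ - ‖Y‖))]
    refine (abs_add_three _ _ _).trans ?_
    rw [e1, e2, e3]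
    nlinarith [mul_nonneg (abs_nonneg a) (sq_nonneg ‖Y‖), mul_nonneg (abs_nonneg b) (sq_nonneg ‖X‖)]
  have h6 := abs_le.1 ((abs_mul s _).trans_le ((mul_le_mul_of_nonneg_left h5 (abs_nonneg s)).trans
    (le_of_eq (mul_assoc _ _ _).symm)))
  nlinarith [mul_le_mul_of_nonneg_right hs (by positivity : 0 ≤ ‖X‖ ^ 2 + ‖Y‖ ^ 2), h6.1]

theorem eq_proj_of_columns_dependent {d : ℕ} {ι : Type*} [Fintype ι] (B : Matrix (Fin d) ι ℂ)
    (h : ∀ k l, ∃ α β : ℂ, (α ≠ 0 ∨ β ≠ 0) ∧ ∀ i, α * B i k + β * B i l = 0) :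
    ∃ η : EuclideanSpace ℂ (Fin d), B * Bᴴ = proj η := by
  by_cases h0 : ∀ i k, B i k = 0
  · refine ⟨0, ?_⟩
    ext i j
    simp [mul_apply, h0, proj]
  · push Not at h0
    obtain ⟨i₀, k, hik⟩ := h0
    have hc : ∀ l, ∃ c : ℂ, ∀ i, B i l = c * B i k := by
      intro l
      obtain ⟨α, β, hαβ, he⟩ := h k l
      have hβ : β ≠ 0 := by
        rintro rfl
        have := he i₀
        simp only [zero_mul, add_zero, mul_eq_zero, hik, or_false] at this
        simp [this] at hαβ
      refine ⟨-α / β, fun i => ?_⟩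
      have := he i
      field_simp
      linear_combination this
    choose c hc using hc
    have hr : (0 : ℝ) ≤ ∑ l, ‖c l‖ ^ 2 := by positivity
    refine ⟨WithLp.toLp 2 fun i => (Real.sqrt (∑ l, ‖c l‖ ^ 2) : ℂ) * B i k, ?_⟩
    ext i j
    simp only [mul_apply, conjTranspose_apply, proj, of_apply, star_mul', RCLike.star_def,
      Complex.conj_ofReal]
    rw [mul_mul_mul_comm, ← Complex.ofReal_mul, Real.mul_self_sqrt hr, Complex.ofReal_sum,
      Finset.sum_mul]
    refine Finset.sum_congr rfl fun l _ => ?_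
    rw [hc l i, hc l j, map_mul, mul_mul_mul_comm, Complex.mul_conj']
    push_cast
    rfl

/-- In dimension at most three, the extreme points of `relaxedSet d m` are pure states. -/
theorem exists_eq_proj_of_mem_extremePoints {d m : ℕ} (hd : d ≤ 3) {ω : Op d}
    (hω : ω ∈ (relaxedSet d m).extremePoints ℝ) :
    ∃ η : EuclideanSpace ℂ (Fin d), ω = proj η := by
  obtain ⟨hmem, hext⟩ := mem_extremePoints.1 hω
  have hst := mem_relaxedSet_iff.1 hmem
  have hS : (CFC.sqrt ω).PosSemidef := (CFC.sqrt_nonneg _).posSemidef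
  obtain ⟨B, hB⟩ : ∃ B : Op d, ω = B * Bᴴ := ⟨CFC.sqrt ω, by
    rw [hS.isHermitian.eq]; exact (CFC.sqrt_mul_sqrt_self _ hst.1.1.nonneg).symm⟩
  by_contra hne
  have hdep : ¬ ∀ k l, ∃ α β : ℂ, (α ≠ 0 ∨ β ≠ 0) ∧ ∀ i, α * B i k + β * B i l = 0 := by
    intro h
    obtain ⟨η, hη⟩ := eq_proj_of_columns_dependent B h
    exact hne ⟨η, hB.trans hη⟩
  push Not at hdep
  obtain ⟨k, l, hkl⟩ := hdep
  have hind : ∀ α β : ℂ, α • (fun i => B i k) + β • (fun i => B i l) = 0 → α = 0 ∧ β = 0 := by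
    intro α β h
    by_contra hαβ
    obtain ⟨i, hi⟩ := hkl α β (by tauto)
    exact hi (congrFun h i)
  have hkl' : k ≠ l := by
    rintro rfl
    have := (hind 1 (-1) (by ext; simp)).1
    exact one_ne_zero this
  obtain ⟨a, b, c, habc, hdiag⟩ :=
    exists_pairHermitian_diag_eq_zero hd (fun i => B i k) (fun i => B i l)
  set H := pairHermitian (fun i => B i k) (fun i => B i l) a b c with hH
  have hH0 : H ≠ 0 := pairHermitian_ne_zero hind habc
  have hN : 0 < 1 + (|a| + |b| + ‖c‖) := by positivity
  set s : ℝ := 1 / (1 + (|a| + |b| + ‖c‖)) with hs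
  have hs0 : 0 < s := by positivity
  have hs1 : |s| * (|a| + |b| + ‖c‖) ≤ 1 := by
    rw [abs_of_pos hs0, hs, one_div, inv_mul_le_iff₀ hN]
    linarith
  -- As `H` has zero diagonal, trace and populations are unchanged; only positivity limits `r`.
  -- Taking `r = ±s` makes `ω` the midpoint of two other members.
  have hmem' : ∀ r : ℝ, |r| * (|a| + |b| + ‖c‖) ≤ 1 → ω + (r : ℂ) • H ∈ relaxedSet d m := by
    intro r hr
    have hd' : ∀ i, (ω + (r : ℂ) • H) i i = ω i i := fun i => by
      rw [Matrix.add_apply, Matrix.smul_apply, hdiag i, smul_zero, add_zero]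
    refine mem_relaxedSet_iff.2 ⟨⟨hB ▸ posSemidef_add_pairHermitian B hkl' hr, ?_⟩, fun i => ?_⟩
    · rw [← hst.1.2]
      exact Finset.sum_congr rfl fun i _ => hd' i
    · rw [hd']; exact hst.2 i
  have hseg : ω ∈ openSegment ℝ (ω + (s : ℂ) • H) (ω + ((-s : ℝ) : ℂ) • H) := by
    refine ⟨1 / 2, 1 / 2, by norm_num, by norm_num, by norm_num, ?_⟩
    ext i j
    apply Complex.ext <;> simp <;> ring
  have := (hext _ (hmem' s hs1) _ (hmem' (-s) (by rwa [abs_neg])) hseg).1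
  rw [add_eq_left, smul_eq_zero] at this
  rcases this with h | h
  · exact hs0.ne' (by exact_mod_cast h)
  · exact hH0 h

/-! ### Attaining the relaxed fidelity in dimension at most three. -/

theorem sum_norm_mul_le_assistedFidelity {d m : ℕ} {ι : Type*} [Fintype ι] (hm : 1 ≤ m)
    (hmd : m ≤ d) (O : FreeClass) {ρ : Op d} (hρ : IsState ρ) {A : Matrix (Fin d) ι ℂ}
    (hA : A * Aᴴ = ρ) {η : ι → EuclideanSpace ℂ (Fin d)} (hη : ∀ i, ‖η i‖ = 1)
    (hdiag : ∀ i j, ‖η i j‖ ^ 2 ≤ 1 / (m : ℝ)) :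
    ∑ i, ‖star (η i : Fin d → ℂ) ⬝ᵥ fun j => A j i‖ ^ 2 ≤ assistedFidelity O ρ m := by
  have hψ : ∀ i, ∃ ψ : EuclideanSpace ℂ (Fin d), ‖ψ‖ = 1 ∧
      ∃ r : ℝ, 0 ≤ r ∧ ∀ j, A j i = (r : ℂ) * ψ j := by
    intro i
    set a : EuclideanSpace ℂ (Fin d) := WithLp.toLp 2 fun j => A j i
    by_cases ha : a = 0
    · refine ⟨η i, hη i, 0, le_rfl, fun j => ?_⟩
      have : a j = 0 := by rw [ha]; rfl
      simpa [a] using this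
    · refine ⟨(‖a‖⁻¹ : ℂ) • a, norm_smul_inv_norm ha, ‖a‖, norm_nonneg a, fun j => ?_⟩
      have hn : (‖a‖ : ℂ) ≠ 0 := by exact_mod_cast norm_ne_zero_iff.2 ha
      rw [PiLp.smul_apply, smul_eq_mul, mul_inv_cancel_left₀ hn]
  choose ψ hψ1 r hr0 hr using hψ
  choose Λ hΛ hΛF using fun i => exists_mem_norm_sq_le O hm hmd (hη i) (hdiag i)
  have hsum : ρ = ∑ i, ((r i ^ 2 : ℝ) : ℂ) • proj (ψ i) := by
    rw [← sum_smul_proj_eq (fun i => sq_nonneg (r i)), ← hA]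
    simp only [Real.sqrt_sq (hr0 _), ← hr]
    rfl
  have hr1 : ∑ i, r i ^ 2 = 1 := by
    have := hρ.2
    rw [hsum, trace_sum] at this
    simp only [trace_smul, (isState_proj (hψ1 _)).2, smul_eq_mul, mul_one] at this
    exact_mod_cast this
  let e := (Fintype.equivFin ι).symm
  have hdec : IsPureDecomposition ρ (fun l => r (e l) ^ 2) (fun l => ψ (e l)) :=
    ⟨fun l => sq_nonneg _, by rw [e.sum_comp fun i => r i ^ 2, hr1], fun l => hψ1 _, by
      rw [e.sum_comp fun i => ((r i ^ 2 : ℝ) : ℂ) • proj (ψ i), ← hsum]⟩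
  refine le_trans ?_ (le_assistedFidelity hm hmd hdec fun l => hΛ (e l))
  rw [hsInner_sum_smul_re, e.sum_comp fun i => r i ^ 2 * (hsInner (Λ i (proj (ψ i))) (maxCoh d m)).re]
  refine Finset.sum_le_sum fun i _ => ?_
  have : (fun j => A j i) = (r i : ℂ) • (ψ i : Fin d → ℂ) := funext fun j => hr i j
  rw [this, dotProduct_smul, norm_smul, mul_pow, Complex.norm_real, Real.norm_eq_abs, sq_abs]
  exact mul_le_mul_of_nonneg_left (hΛF i (ψ i)) (sq_nonneg _)

theorem fidelity_le_of_mem_convexHull {d m : ℕ} (hd : d ≤ 3) (hm : 1 ≤ m) (hmd : m ≤ d)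
    (O : FreeClass) {ρ : Op d} (hρ : IsState ρ) {ω : Op d}
    (hω : ω ∈ convexHull ℝ ((relaxedSet d m).extremePoints ℝ)) (hdet : ω.det ≠ 0) :
    fidelity ρ ω ≤ assistedFidelity O ρ m := by
  have hmem : ω ∈ relaxedSet d m :=
    closure_convexHull_extremePoints_relaxedSet d m ▸ subset_closure hω
  obtain ⟨ι, _, w, z, hw0, hw1, hz, hsum⟩ := mem_convexHull_iff_exists_fintype.1 hω
  choose η hη using fun i => exists_eq_proj_of_mem_extremePoints hd (hz i)
  have hz' : ∀ i, proj (η i) ∈ relaxedSet d m := fun i => hη i ▸ (hz i).1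
  have hη1 : ∀ i, ‖η i‖ = 1 := fun i => by
    have h := (hz' i).1.2
    rw [trace_proj, ← sum_sq_norm_eq_star_dotProduct, ← EuclideanSpace.norm_sq_eq] at h
    have h' : ‖η i‖ ^ 2 = 1 := by exact_mod_cast h
    exact (pow_eq_one_iff_of_nonneg (norm_nonneg _) two_ne_zero).1 h'
  have hdiag : ∀ i j, ‖η i j‖ ^ 2 ≤ 1 / (m : ℝ) := fun i j => by
    have h := (mem_relaxedSet_iff.1 (hz' i)).2 j
    rw [proj, of_apply, RCLike.star_def, Complex.mul_conj'] at h
    exact_mod_cast h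
  let B : Matrix (Fin d) ι ℂ := of fun j i => (Real.sqrt (w i) : ℂ) * η i j
  have hB : B * Bᴴ = ω := by
    rw [sum_smul_proj_eq hw0, ← hsum]
    refine Finset.sum_congr rfl fun i _ => ?_
    rw [hη i]
    ext a b
    simp
  obtain ⟨A, hA, htr⟩ := exists_mul_conjTranspose_eq_of_posDef hρ.1 (B := B)
    (by rw [hB]; exact hmem.1.1.posDef_iff_det_ne_zero.2 hdet)
  rw [hB] at htr
  refine le_trans ?_ (sum_norm_mul_le_assistedFidelity hm hmd O hρ hA hη1 hdiag)
  rw [fidelity, ← htr]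
  have e : (Aᴴ * B).trace.re =
      ∑ i, Real.sqrt (w i) * (star (η i : Fin d → ℂ) ⬝ᵥ fun j => A j i).re := by
    rw [trace, Complex.re_sum]
    refine Finset.sum_congr rfl fun i _ => ?_
    have : (Aᴴ * B) i i =
        (Real.sqrt (w i) : ℂ) * star (star (η i : Fin d → ℂ) ⬝ᵥ fun j => A j i) := by
      rw [← star_dotProduct, mul_apply, dotProduct, Finset.mul_sum]
      refine Finset.sum_congr rfl fun j _ => ?_
      simp only [B, conjTranspose_apply, of_apply, Pi.star_apply]
      ring
    rw [diag_apply, this, Complex.re_ofReal_mul, RCLike.star_def, Complex.conj_re]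
  rw [e]
  -- Cauchy-Schwarz against the unit vector `√w` removes the mixture weights, leaving the sum of
  -- squared overlaps that assistance achieves.
  refine (Finset.sum_mul_sq_le_sq_mul_sq _ _ _).trans ?_
  simp only [Real.sq_sqrt (hw0 _)]
  rw [hw1, one_mul]
  refine Finset.sum_le_sum fun i _ => ?_
  rw [← sq_abs]
  exact pow_le_pow_left₀ (abs_nonneg _) (Complex.abs_re_le_norm _) 2

/-- Krein-Milman places `ω` only in the closure of the hull. A strict violation and `det ≠ 0` both
persist at nearby states, so they would hold at a point of the hull itself. -/
theorem fidelity_le_of_det_ne_zero {d m : ℕ} (hd : d ≤ 3) (hm : 1 ≤ m) (hmd : m ≤ d)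
    (O : FreeClass) {ρ : Op d} (hρ : IsState ρ) {ω : Op d} (hω : ω ∈ relaxedSet d m)
    (hdet : ω.det ≠ 0) : fidelity ρ ω ≤ assistedFidelity O ρ m := by
  by_contra! h
  have h1 := ((continuousOn_fidelity_isState ρ) ω hω.1).eventually (lt_mem_nhds h)
  have h2 : ∀ᶠ X : Op d in nhds ω, X.det ≠ 0 :=
    (continuous_id.matrix_det.continuousAt (x := ω)).eventually_ne hdet
  have h3 := mem_closure_iff_frequently.1
    ((closure_convexHull_extremePoints_relaxedSet d m).symm ▸ hω)
  obtain ⟨X, hX, hX1, hX2⟩ := (h3.and_eventually ((eventually_nhdsWithin_iff.1 h1).and h2)).exists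
  have hXm : X ∈ relaxedSet d m :=
    closure_convexHull_extremePoints_relaxedSet d m ▸ subset_closure hX
  exact (hX1 hXm.1).not_ge (fidelity_le_of_mem_convexHull hd hm hmd O hρ hX hX2)

theorem sdpFidelity_le_assistedFidelity {d m : ℕ} (hd : d ≤ 3) (hm : 1 ≤ m) (hmd : m ≤ d)
    (O : FreeClass) {ρ : Op d} (hρ : IsState ρ) :
    sdpFidelity ρ m ≤ assistedFidelity O ρ m := by
  obtain ⟨ω, hω, e⟩ := exists_fidelity_eq_sdpFidelity ρ hm hmd
  rw [e]
  by_contra! h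
  -- The optimal `ω` may be singular. Mixing in the maximally mixed state stays inside `relaxedSet`,
  -- is positive definite for `0 < δ < 1`, and tends to `ω`.
  let γ : ℝ → Op d := fun δ => (1 - δ) • ω + δ • ((d : ℂ)⁻¹ • (1 : Op d))
  have hγ0 : γ 0 = ω := by simp [γ]
  have hγm : ∀ δ ∈ Set.Ioo (0 : ℝ) 1, γ δ ∈ relaxedSet d m := fun δ hδ =>
    convex_relaxedSet d m hω (maximallyMixed_mem_relaxedSet hm hmd) (by linarith [hδ.2])
      hδ.1.le (by ring)
  have hγdet : ∀ δ ∈ Set.Ioo (0 : ℝ) 1, (γ δ).det ≠ 0 := fun δ hδ => by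
    have hd0 : (0 : ℂ) < (d : ℂ)⁻¹ := by
      have : (0 : ℝ) < (d : ℝ)⁻¹ := by
        have : 0 < d := by omega
        positivity
      simpa using Complex.zero_lt_real.2 this
    have : (γ δ).PosDef := PosDef.posSemidef_add
      (hω.1.1.smul (by linarith [hδ.2] : 0 ≤ 1 - δ)) ((PosDef.one.smul hd0).smul hδ.1)
    exact this.det_pos.ne'
  have hγc : Continuous γ := by fun_prop
  have hlim : Filter.Tendsto γ (nhdsWithin 0 (Set.Ioo 0 1)) (nhdsWithin ω {ω | IsState ω}) := by
    refine tendsto_nhdsWithin_iff.2 ⟨?_, ?_⟩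
    · have := hγc.tendsto 0
      rw [hγ0] at this
      exact this.mono_left nhdsWithin_le_nhds
    · filter_upwards [self_mem_nhdsWithin] with δ hδ using (hγm δ hδ).1
  have h1 := hlim.eventually
    (((continuousOn_fidelity_isState ρ) ω hω.1).eventually (lt_mem_nhds h))
  have : (nhdsWithin (0 : ℝ) (Set.Ioo 0 1)).NeBot := left_nhdsWithin_Ioo_neBot one_pos
  obtain ⟨δ, hδ1, hδ⟩ := (h1.and self_mem_nhdsWithin).exists
  exact hδ1.not_ge (fidelity_le_of_det_ne_zero hd hm hmd O hρ (hγm δ hδ) (hγdet δ hδ))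

theorem assistedRate_eq_sdpRate {d : ℕ} (hd : d ≤ 3) (O : FreeClass) {ρ : Op d} (hρ : IsState ρ)
    (ε : ℝ) : assistedRate O ε ρ = sdpRate ε ρ := by
  unfold assistedRate sdpRate
  congr 3
  ext m
  refine and_congr_right fun hm => and_congr_right fun hmd => ?_
  rw [le_antisymm (assistedFidelity_le_sdpFidelity O ρ hm hmd)
    (sdpFidelity_le_assistedFidelity hd hm hmd O hρ)]

end AssistedCoherence

theorem mainTheorem5 (O : AssistedCoherence.FreeClass) (d : ℕ) (ρ : AssistedCoherence.Op d)
    (hρ : AssistedCoherence.IsState ρ) (ε : ℝ) (hε : 0 ≤ ε) :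
    -- the SDP quantity equals `log₂ ⌊2 ^ (- log₂ κ)⌋`, where `κ` is the (attained) minimum of
    -- `‖Δ(ω)‖_∞` over `ω ∈ B_ε(ρ)`
    (∃ κ : ℝ,
      IsLeast ((fun ω => AssistedCoherence.opNorm (AssistedCoherence.dephase ω)) ''
        AssistedCoherence.fidelityBall ε ρ) κ ∧
      AssistedCoherence.sdpRate ε ρ = AssistedCoherence.logFloor (-Real.logb 2 κ)) ∧
    -- the bound, and its tightness in dimension at most three
    AssistedCoherence.assistedRate O ε ρ ≤ AssistedCoherence.sdpRate ε ρ ∧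
    (d ≤ 3 → AssistedCoherence.assistedRate O ε ρ = AssistedCoherence.sdpRate ε ρ) :=
  ⟨AssistedCoherence.exists_isLeast_and_sdpRate_eq hρ hε,
    AssistedCoherence.assistedRate_le_sdpRate O ρ ε,
    fun hd => AssistedCoherence.assistedRate_eq_sdpRate hd O hρ ε⟩
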